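/- Let $\bar\sigma:[0,1]^3\to[-1,1]$ be a measurable function. Let $w$, $(u_l)_{l\ge1}$, $(v_i)_{i\ge 1}$ be i.i.d. uniform on $[0,1]$, and write $u$ for a copy of $u_1$ and $\mathbb E_v$ for the expectation in a uniform variable $v$ on $[0,1]$ only. For distinct $l_1,\dots,l_k\ge1$ let $$R_{l_1,\dots,l_k}=\mathbb E_v\,\bar\sigma(w,u_{l_1},v)\cdots\bar\sigma(w,u_{l_k},v)$$ be the multi-overlaps. For $p\ge1$ and $w\in[0,1]$ let $g_p(\bar\sigma(w,u,\cdot))$ be a (jointly measurable) centered Gaussian process indexed by $u\in[0,1]$ with covariance $$\operatorname{Cov}\bigl(g_p(\bar\sigma(w,u,\cdot)),g_p(\bar\sigma(w,u',\cdot))\bigr)=\bigl(\mathbb E_v\bar\sigma(w,u,v)\bar\sigma(w,u',v)\bigr)^p,$$ whose randomness is independent of all other variables, and let $$G_p(\bar\sigma(w,u,\cdot))=g_p(\bar\sigma(w,u,\cdot))+z\bigl(1-(\mathbb E_v\bar\sigma(w,u,v)^2)^p\bigr)^{1/2}$$ with $z$ an independent standard Gaussian. Let $\mathbb E'$ denote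 the expectation in $u$ and $z$ only. Assume that the following stochastic stability holds: for all $p\ge 1$, $t>0$, $q,m\ge1$ and all subsets $C_1,\dots,C_q\subseteq\{1,\dots,m\}$, with $\bar\sigma_i=\bar\sigma(w,u,v_i)$, $$\mathbb E\prod_{l\le q}\mathbb E'\prod_{i\in C_l}\bar\sigma_i=\mathbb E\,\frac{\prod_{l\le q}\mathbb E'\prod_{i\in C_l}\bar\sigma_i\,\exp tG_p(\bar\sigma(w,u,\cdot))}{\bigl(\mathbb E'\exp tG_p(\bar\sigma(w,u,\cdot))\bigr)^q}.$$ Then the following are equivalent: (1) (Ghirlanda--Guerra identities) for all $n\ge1$, all $p\ge1$ and every continuous function $F$ of the multi-overlaps of the replicas $1,\dots,n$, $$\mathbb E\,F\,R_{1,n+1}^p=\frac1n\,\mathbb E F\;\mathbb E R_{1,2}^p+\frac1n\sum_{l=2}^n\mathbb E\,F\,R_{1,l}^p;$$ (2) for every $p\ge1$, the quantity $$\mathbb E\frac{G_p(\bar\sigma(w,u,\cdot))^2\exp tG_p(\bar\sigma(w,u,\cdot))}{\mathbb E'\exp tG_p(\bar\sigma(w,u,\cdot))}-\Bigl(\mathbb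 E\frac{G_p(\bar\sigma(w,u,\cdot))\exp tG_p(\bar\sigma(w,u,\cdot))}{\mathbb E'\exp tG_p(\bar\sigma(w,u,\cdot))}\Bigr)^2$$ is bounded uniformly over all $t>0$. Moreover, if (1) and (2) hold, then the quantity in (2) equals $1$ for all $p\ge1$ and all $t>0$. -/

import Mathlib

open MeasureTheory ProbabilityTheory
open scoped unitInterval

noncomputable section

namespace SpinGlass

/-- The multi-overlap `𝔼_v ∏_{l ∈ S} σ̄(w, u_l, v)` of the (distinct) replicas with indices in `S`. -/
def multiOverlap {ι : Type*} (s : I → I → I → ℝ) (w : I) (u : ι → I) (S : Finset ι) : ℝ :=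
  ∫ v : I, ∏ l ∈ S, s w (u l) v

/-- The overlap `𝔼_v σ̄(w, u, v) σ̄(w, u', v)` of two replicas. -/
def overlap (s : I → I → I → ℝ) (w u u' : I) : ℝ :=
  ∫ v : I, s w u v * s w u' v

/-- The Ghirlanda-Guerra identities for `σ̄`: for all `n, p ≥ 1` and every continuous function `F`
of the multi-overlaps of `n` replicas,
`𝔼 F R_{1,n+1}^p = n⁻¹ 𝔼 F 𝔼 R_{1,2}^p + n⁻¹ ∑_{l=2}^n 𝔼 F R_{1,l}^p`.
The `n + 1` replicas are indexed by `Fin (n + 1)`, starting from `0`; the function `F` has access to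
the replicas `0, …, n - 1`. -/
def GhirlandaGuerra (s : I → I → I → ℝ) : Prop :=
  ∀ n : ℕ, 1 ≤ n → ∀ p : ℕ, 1 ≤ p → ∀ F : (Finset (Fin n) → ℝ) → ℝ, Continuous F →
    ∫ w : I, ∫ u : Fin (n + 1) → I,
        F (multiOverlap s w fun l => u l.castSucc) * overlap s w (u 0) (u (Fin.last n)) ^ p
      = (1 / (n : ℝ)) *
          ((∫ w : I, ∫ u : Fin n → I, F (multiOverlap s w u)) *
            ∫ w : I, ∫ u : I, ∫ u' : I, overlap s w u u' ^ p)
        + (1 / (n : ℝ)) * ∑ l ∈ Finset.Ioo 0 (Fin.last n),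
            ∫ w : I, ∫ u : Fin (n + 1) → I,
              F (multiOverlap s w fun k => u k.castSucc) * overlap s w (u 0) (u l) ^ p

/-- `g w u ω` is a jointly measurable realization, on the probability space `(Ω, P)`, of the family
of processes `g_p(σ̄(w, u, ·))`: for every `w`, a centered Gaussian process indexed by `u ∈ [0,1]`
with covariance `(𝔼_v σ̄(w, u, v) σ̄(w, u', v))^p`. -/
structure IsOverlapGaussianProcess {Ω : Type*} [MeasurableSpace Ω] (P : Measure Ω)
    (s : I → I → I → ℝ) (p : ℕ) (g : I → I → Ω → ℝ) : Prop where
  measurable : Measurable fun x : I × I × Ω => g x.1 x.2.1 x.2.2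
  isGaussianProcess : ∀ w, IsGaussianProcess (g w) P
  mean_eq_zero : ∀ w u, ∫ ω, g w u ω ∂P = 0
  covariance_eq : ∀ w u u', cov[g w u, g w u'; P] = overlap s w u u' ^ p

/-- The process
`G_p(σ̄(w, u, ·)) = g_p(σ̄(w, u, ·)) + z (1 - (𝔼_v σ̄(w, u, v)²)^p)^{1/2}`. -/
def bigG {Ω : Type*} (s : I → I → I → ℝ) (p : ℕ) (g : I → I → Ω → ℝ) (w u : I) (ω : Ω) (z : ℝ) :
    ℝ :=
  g w u ω + z * √(1 - overlap s w u u ^ p)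

/-- The expectation `𝔼'` in the replica variables: `u` uniform on `[0,1]` and an independent
standard Gaussian `z`. -/
def replicaE (f : I → ℝ → ℝ) : ℝ :=
  ∫ u : I, ∫ z : ℝ, f u z ∂gaussianReal 0 1

/-- The stochastic stability equation for fixed `p` and `t`: for all `q`, `m` and all subsets
`C_l`, `l ≤ q`, of `{1, …, m}`,
`𝔼 ∏_l 𝔼' ∏_{i ∈ C_l} σ̄_i = 𝔼 [∏_l 𝔼' (∏_{i ∈ C_l} σ̄_i) exp(t G_p) / (𝔼' exp(t G_p))^q]`
where `σ̄_i = σ̄(w, u, v_i)`. -/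
def StochasticallyStableAt {Ω : Type*} [MeasurableSpace Ω] (P : Measure Ω)
    (s : I → I → I → ℝ) (p : ℕ) (g : I → I → Ω → ℝ) (t : ℝ) : Prop :=
  ∀ q : ℕ, 1 ≤ q → ∀ m : ℕ, 1 ≤ m → ∀ C : Fin q → Finset (Fin m),
    ∫ w : I, ∫ v : Fin m → I, ∏ l : Fin q, replicaE (fun u _ => ∏ i ∈ C l, s w u (v i))
      = ∫ w : I, ∫ v : Fin m → I, ∫ ω,
          (∏ l : Fin q, replicaE fun u z =>
              (∏ i ∈ C l, s w u (v i)) * Real.exp (t * bigG s p g w u ω z)) /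
            (replicaE fun u z => Real.exp (t * bigG s p g w u ω z)) ^ q ∂P

/-- The `k`-th moment of `G_p` under the tilted measure,
`𝔼 [G_p(σ̄(w, u, ·))^k exp(t G_p(σ̄(w, u, ·))) / 𝔼' exp(t G_p(σ̄(w, u, ·)))]`. -/
def tiltedMoment {Ω : Type*} [MeasurableSpace Ω] (P : Measure Ω)
    (s : I → I → I → ℝ) (p : ℕ) (g : I → I → Ω → ℝ) (t : ℝ) (k : ℕ) : ℝ :=
  ∫ w : I, ∫ ω,
    (replicaE fun u z => bigG s p g w u ω z ^ k * Real.exp (t * bigG s p g w u ω z)) /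
      (replicaE fun u z => Real.exp (t * bigG s p g w u ω z)) ∂P

/-- The variance of `G_p` under the tilted measure. -/
def tiltedVariance {Ω : Type*} [MeasurableSpace Ω] (P : Measure Ω)
    (s : I → I → I → ℝ) (p : ℕ) (g : I → I → Ω → ℝ) (t : ℝ) : ℝ :=
  tiltedMoment P s p g t 2 - tiltedMoment P s p g t 1 ^ 2

end SpinGlass

end

/-! Replicas are drawn from the random Gibbs measure with density `exp (t G_p) / 𝔼' exp (t G_p)`;
write `⟨·⟩` for this draw, `R` for overlaps, and number the replicas from 0. The variable `z` is
integrated out explicitly: it multiplies the weight by `exp (t² (1 - R₀₀^p) / 2)` and makes the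
covariance of `G_p` with itself equal to 1 at every replica.

Stochastic stability identifies the joint moments of the multi-overlaps under this measure with
those under uniform sampling. Since multi-overlaps are bounded, the two laws coincide
(`StochasticallyStableAt.integral_multiOverlap`).

Gaussian integration by parts (`integral_affineTest_mul_tiltedField`), for `F` depending on `n + 1`
replicas, gives `𝔼⟨F G_p⟩ = t 𝔼⟨F (1 + ∑_{1 ≤ l ≤ n} R_{0,l}^p - (n + 1) R_{0,n+1}^p)⟩`. By
stability the right side is `t (𝔼F (1 - 𝔼R_{0,1}^p) + D(F))`, where `D(F)` is the Ghirlanda-Guerra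
defect `ggDefect`. The choice `F = 1` has no defect and gives the mean of `G_p`, so the covariance
of `F` and `G_p` is exactly `t D(F)`.

Integrating by parts twice gives `Var G_p = 1 - t² D(R_{0,1}^p)` (`tiltedVariance_eq`), so the
identities force the variance to be 1. Conversely, Cauchy-Schwarz gives `(t D(F))² ≤ C² Var G_p`
when `|F| ≤ C` (`sq_mul_ggDefect_le`). If the variance stays bounded as `t → ∞`, then `D(F) = 0`.

Integration by parts is obtained by differentiating a Cameron-Martin shift at `ε = 0`. The partition
function involves the whole path of the process, and Monte Carlo sampling reduces it to countably
many coordinates. -/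

noncomputable section

namespace SpinGlass

/-! ### Cameron-Martin formula for Gaussian processes. -/

section GaussianShift

variable {Ω : Type*} [MeasurableSpace Ω] {P : Measure Ω}

lemma mgf_eq_of_hasGaussianLaw {Y : Ω → ℝ} (hY : HasGaussianLaw Y P) (h0 : ∫ ω, Y ω ∂P = 0)
    (c : ℝ) : mgf Y P c = Real.exp (c ^ 2 * Var[Y; P] / 2) := by
  rw [mgf_gaussianReal hY.map_eq_gaussianReal, h0, Real.coe_toNNReal _ (variance_nonneg _ _)]
  congr 1
  ring

lemma integral_exp_of_hasGaussianLaw {Y : Ω → ℝ} (hY : HasGaussianLaw Y P)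
    (h0 : ∫ ω, Y ω ∂P = 0) : ∫ ω, Real.exp (Y ω) ∂P = Real.exp (Var[Y; P] / 2) := by
  have := mgf_eq_of_hasGaussianLaw hY h0 1
  simpa [mgf] using this

lemma integrable_exp_of_hasGaussianLaw {Y : Ω → ℝ} (hY : HasGaussianLaw Y P)
    (h0 : ∫ ω, Y ω ∂P = 0) (c : ℝ) : Integrable (fun ω => Real.exp (c * Y ω)) P := by
  by_contra h
  have := mgf_eq_of_hasGaussianLaw hY h0 c
  -- The mgf of a non-integrable exponential is 0 by convention, which contradicts the positive
  -- Gaussian formula.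
  rw [mgf_undef h] at this
  exact (Real.exp_pos _).ne this

/-- The exponential tilt of `P` by the Gaussian variable `ε Y`. -/
def gaussianTilt (P : Measure Ω) (Y : Ω → ℝ) (ε : ℝ) : Measure Ω :=
  P.withDensity fun ω => ENNReal.ofReal (Real.exp (ε * Y ω - ε ^ 2 * Var[Y; P] / 2))

lemma integral_gaussianTilt {Y : Ω → ℝ} (hYm : Measurable Y) (ε : ℝ) (f : Ω → ℝ) :
    ∫ ω, f ω ∂(gaussianTilt P Y ε)
      = ∫ ω, f ω * Real.exp (ε * Y ω - ε ^ 2 * Var[Y; P] / 2) ∂P := by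
  rw [gaussianTilt, integral_withDensity_eq_integral_toReal_smul (by fun_prop) (by simp)]
  refine integral_congr_ae (.of_forall fun ω => ?_)
  simp only [ENNReal.toReal_ofReal (Real.exp_pos _).le, smul_eq_mul]
  ring

lemma isProbabilityMeasure_gaussianTilt {Y : Ω → ℝ} (hY : HasGaussianLaw Y P)
    (h0 : ∫ ω, Y ω ∂P = 0) (ε : ℝ) : IsProbabilityMeasure (gaussianTilt P Y ε) := by
  have := hY.isProbabilityMeasure
  constructor
  have hint : Integrable (fun ω => Real.exp (ε * Y ω - ε ^ 2 * Var[Y; P] / 2)) P := by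
    simp_rw [Real.exp_sub]
    exact (integrable_exp_of_hasGaussianLaw hY h0 ε).div_const _
  rw [gaussianTilt, withDensity_apply _ MeasurableSet.univ, setLIntegral_univ,
    ← ofReal_integral_eq_lintegral_ofReal hint (.of_forall fun ω => (Real.exp_pos _).le)]
  simp_rw [Real.exp_sub]
  rw [integral_div]
  have h := mgf_eq_of_hasGaussianLaw hY h0 ε
  rw [mgf] at h
  rw [h, div_self (Real.exp_pos _).ne']
  simp

/-- The variable `c V + ε Y` is centered Gaussian. In its variance the cross term `2 c ε cov[V, Y]`
is the effect of a shift of `V`, and the term `ε² Var Y` is cancelled by the normalization of the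
tilt. -/
lemma mgf_gaussianTilt {Y V : Ω → ℝ} (hYm : Measurable Y)
    (hVY : HasGaussianLaw (fun ω => (V ω, Y ω)) P) (hY0 : ∫ ω, Y ω ∂P = 0)
    (hV0 : ∫ ω, V ω ∂P = 0) (ε : ℝ) :
    mgf V (gaussianTilt P Y ε) = mgf (fun ω => V ω + ε * cov[V, Y; P]) P := by
  have := hVY.isProbabilityMeasure
  ext c
  have hcV : HasGaussianLaw (fun ω => c * V ω) P := hVY.fst.fun_smul c
  have hsum : HasGaussianLaw (fun ω => c * V ω + ε * Y ω) P :=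
    hVY.map_fun (c • ContinuousLinearMap.fst ℝ ℝ ℝ + ε • ContinuousLinearMap.snd ℝ ℝ ℝ)
  have hsum0 : ∫ ω, (c * V ω + ε * Y ω) ∂P = 0 := by
    rw [integral_add (hVY.fst.integrable.const_mul _) (hVY.snd.integrable.const_mul _),
      integral_const_mul, integral_const_mul, hY0, hV0]
    simp
  have hvar : Var[fun ω => c * V ω + ε * Y ω; P]
      = c ^ 2 * Var[V; P] + 2 * (c * (ε * cov[V, Y; P])) + ε ^ 2 * Var[Y; P] := by
    rw [variance_fun_add (hVY.fst.memLp_two.const_mul c) (hVY.snd.memLp_two.const_mul ε),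
      variance_const_mul, variance_const_mul, covariance_const_mul_left,
      covariance_const_mul_right]
  have h1 := integral_exp_of_hasGaussianLaw hsum hsum0
  have h2 := mgf_eq_of_hasGaussianLaw hVY.fst hV0 c
  rw [mgf_add_const, h2, mgf, integral_gaussianTilt hYm]
  have : ∀ ω, Real.exp (c * V ω) * Real.exp (ε * Y ω - ε ^ 2 * Var[Y; P] / 2)
      = Real.exp (c * V ω + ε * Y ω) * Real.exp (- (ε ^ 2 * Var[Y; P] / 2)) := fun ω => by
    rw [← Real.exp_add, ← Real.exp_add]
    congr 1
    ring
  simp_rw [this]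
  rw [integral_mul_const, h1, hvar, ← Real.exp_add, ← Real.exp_add]
  congr 1
  ring

lemma complexMGF_gaussianTilt {Y V : Ω → ℝ} (hYm : Measurable Y)
    (hVY : HasGaussianLaw (fun ω => (V ω, Y ω)) P) (hY0 : ∫ ω, Y ω ∂P = 0)
    (hV0 : ∫ ω, V ω ∂P = 0) (ε : ℝ) (z : ℂ) :
    complexMGF V (gaussianTilt P Y ε) z = complexMGF (fun ω => V ω + ε * cov[V, Y; P]) P z := by
  have := hVY.isProbabilityMeasure
  have := isProbabilityMeasure_gaussianTilt hVY.snd hY0 ε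
  have hm := mgf_gaussianTilt hYm hVY hY0 hV0 ε
  refine eqOn_complexMGF_of_mgf hm ?_
  -- The mgf is positive exactly where the exponential is integrable. Hence the strip of analytic
  -- continuation is the whole complex plane.
  have : integrableExpSet V (gaussianTilt P Y ε) = Set.univ := by
    refine Set.eq_univ_of_forall fun c => ?_
    rw [integrableExpSet, Set.mem_ofPred_eq, ← mgf_pos_iff, hm, mgf_add_const,
      mgf_eq_of_hasGaussianLaw hVY.fst hV0]
    positivity
  simp [this]

variable {T : Type*} {X : T → Ω → ℝ}

/-- The Cameron-Martin formula for a centered Gaussian process: tilting by `exp (ε X a)` shifts the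
process by `ε` times its covariance with `X a`. -/
theorem map_gaussianTilt_eq_map_add (hX : IsGaussianProcess X P) (hm : ∀ u, Measurable (X u))
    (h0 : ∀ u, ∫ ω, X u ω ∂P = 0) (a : T) (ε : ℝ) :
    (gaussianTilt P (X a) ε).map (fun ω u => X u ω)
      = P.map (fun ω u => X u ω + ε * cov[X u, X a; P]) := by
  classical
  have hP := (hX.hasGaussianLaw_eval a).isProbabilityMeasure
  have hQ := isProbabilityMeasure_gaussianTilt (hX.hasGaussianLaw_eval a) (h0 a) ε
  have hm1 : Measurable (fun ω u => X u ω) := measurable_pi_lambda _ hm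
  have hm2 : Measurable (fun ω u => X u ω + ε * cov[X u, X a; P]) :=
    measurable_pi_lambda _ fun u => (hm u).add_const _
  have h1 := isProjectiveLimit_map (P := gaussianTilt P (X a) ε) (X := X) hm1.aemeasurable
  have h2 := isProjectiveLimit_map (P := P) (X := fun u ω => X u ω + ε * cov[X u, X a; P])
    hm2.aemeasurable
  have key : ∀ J : Finset T, (gaussianTilt P (X a) ε).map (fun ω => J.restrict (X · ω))
      = P.map (fun ω => J.restrict (fun u => X u ω + ε * cov[X u, X a; P])) := by
    intro J
    have hmJ1 : Measurable fun ω => J.restrict (X · ω) := by fun_prop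
    have hmJ2 : Measurable fun ω => J.restrict (fun u => X u ω + ε * cov[X u, X a; P]) := by
      fun_prop
    have := Measure.isProbabilityMeasure_map hmJ1.aemeasurable (μ := gaussianTilt P (X a) ε)
    have := Measure.isProbabilityMeasure_map hmJ2.aemeasurable (μ := P)
    refine Measure.ext_of_charFunDual (funext fun L => ?_)
    -- A functional on `J → ℝ` is a linear combination `V` of coordinates, so only the Gaussian pair
    -- `(V, X a)` matters. The characteristic function is the complex mgf at `Complex.I`.
    set c : J → ℝ := fun j => L (Pi.single j 1) with hc
    have hL : ∀ v : J → ℝ, L v = ∑ j, v j * c j := fun v => by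
      conv_lhs => rw [pi_eq_sum_univ' v]
      simp [hc, map_sum]
    set V : Ω → ℝ := fun ω => ∑ j : J, c j * X j ω with hV
    have hVY : HasGaussianLaw (fun ω => (V ω, X a ω)) P := by
      have hG := hX.hasGaussianLaw (insert a J)
      convert! hG.map_fun ((∑ j : J, c j • ContinuousLinearMap.proj (R := ℝ)
          (φ := fun _ : (insert a J : Finset T) => ℝ) ⟨j, Finset.mem_insert_of_mem j.2⟩).prod
        (ContinuousLinearMap.proj (R := ℝ)
          (φ := fun _ : (insert a J : Finset T) => ℝ) ⟨a, Finset.mem_insert_self a J⟩)) using 1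
      ext ω <;> simp [hV, Finset.restrict]
    have hmem : ∀ j, MemLp (X j) 2 P := fun j => (hX.hasGaussianLaw_eval j).memLp_two
    have hV0 : ∫ ω, V ω ∂P = 0 := by
      simp only [hV]
      rw [integral_finsetSum (f := fun (j : J) ω => c j * X j ω) _
        fun j _ => ((hmem j).integrable one_le_two).const_mul (c j)]
      simp [integral_const_mul, h0]
    have hcov : cov[V, X a; P] = ∑ j : J, c j * cov[X j, X a; P] := by
      rw [hV, covariance_fun_sum_left (fun j : J => (hmem j).const_mul (c j)) (hmem a)]
      simp_rw [covariance_const_mul_left]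
    have := complexMGF_gaussianTilt (hm a) hVY (h0 a) hV0 ε Complex.I
    rw [charFunDual_apply, charFunDual_apply, integral_map hmJ1.aemeasurable (by fun_prop),
      integral_map hmJ2.aemeasurable (by fun_prop)]
    simp only [complexMGF, hcov] at this
    convert this using 4 with ω ω
    · rw [mul_comm, hL, hV]
      simp [mul_comm]
    · rw [mul_comm, hL, hV]
      simp only [Finset.restrict, add_mul, Finset.sum_add_distrib, Finset.mul_sum]
      congr 3
      · exact Finset.sum_congr rfl fun j _ => by ring
      · exact Finset.sum_congr rfl fun j _ => by ring
  -- Both path laws are projective limits of the same finite-dimensional marginals.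
  simp_rw [key] at h1
  exact h1.unique h2

end GaussianShift

/-! ### Path functionals that involve the partition function. -/

section Sampling

open Filter Topology

variable {Ω U : Type*} [MeasurableSpace Ω] [MeasurableSpace U] {P : Measure Ω} {μ : Measure U}
  [IsProbabilityMeasure μ]

/-- Monte Carlo integration: almost every sequence of sample points computes the integrals of a
measurable family of functions, for almost every value of the parameter. -/
lemma ae_tendsto_average [SFinite P] {f : U → Ω → ℝ}
    (hf : Measurable fun x : U × Ω => f x.1 x.2)
    (hint : ∀ᵐ ω ∂P, Integrable (fun u => f u ω) μ) :
    ∀ᵐ v ∂(Measure.infinitePi fun _ : ℕ => μ), ∀ᵐ ω ∂P,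
      Tendsto (fun N : ℕ => (∑ i ∈ Finset.range N, f (v i) ω) / N) atTop
        (𝓝 (∫ u, f u ω ∂μ)) := by
  have hsm : Measurable fun ω => ∫ u, f u ω ∂μ :=
    (hf.comp measurable_swap).stronglyMeasurable.integral_prod_right'.measurable
  have hlaw : ∀ᵐ ω ∂P, ∀ᵐ v ∂(Measure.infinitePi fun _ : ℕ => μ),
      Tendsto (fun N : ℕ => (∑ i ∈ Finset.range N, f (v i) ω) / N) atTop
        (𝓝 (∫ u, f u ω ∂μ)) := by
    filter_upwards [hint] with ω hω
    have hmω : Measurable fun u => f u ω := hf.comp (measurable_id.prodMk measurable_const)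
    have hpres := fun i : ℕ => measurePreserving_eval_infinitePi (fun _ : ℕ => μ) i
    have h := strong_law_ae_real (μ := Measure.infinitePi fun _ : ℕ => μ)
      (fun i v => f (v i) ω) ((hpres 0).integrable_comp_of_integrable hω)
      (fun i j hij => (iIndepFun_infinitePi (P := fun _ : ℕ => μ)
        (X := fun _ u => f u ω) fun _ => hmω).indepFun hij)
      (fun i => ⟨(hmω.comp (hpres i).measurable).aemeasurable,
        (hmω.comp (hpres 0).measurable).aemeasurable, by
          have := fun i => Measure.map_map (μ := Measure.infinitePi fun _ : ℕ => μ) hmω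
            (hpres i).measurable
          simp only [(hpres _).map_eq] at this
          exact (this i).symm.trans (this 0)⟩)
    have h0 : ∫ v, f (v 0) ω ∂(Measure.infinitePi fun _ : ℕ => μ) = ∫ u, f u ω ∂μ := by
      conv_rhs => rw [← (hpres 0).map_eq]
      rw [integral_map (hpres 0).measurable.aemeasurable hmω.aestronglyMeasurable]
    rw [h0] at h
    exact h
  -- The strong law gives, for each good `ω`, almost every sample sequence. The two quantifiers are
  -- exchanged by Fubini, which needs the convergence set to be jointly measurable.
  refine (Measure.ae_ae_comm ?_).1 hlaw
  have : MeasurableSet {x : Ω × (ℕ → U) | Tendsto (fun N : ℕ =>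
      (∑ i ∈ Finset.range N, f (x.2 i) x.1) / N - ∫ u, f u x.1 ∂μ) atTop (𝓝 0)} := by
    refine measurableSet_tendsto _ fun N => ?_
    refine Measurable.sub (Measurable.div_const ?_ _) (hsm.comp measurable_fst)
    refine Finset.measurable_fun_sum _ fun i _ => ?_
    exact hf.comp (g := fun x : U × Ω => f x.1 x.2)
      (f := fun x : Ω × (ℕ → U) => (x.2 i, x.1)) (by fun_prop)
  simpa only [tendsto_sub_nhds_zero_iff] using this

/-- The Cameron-Martin formula for functionals which depend on a Gaussian process through finitely
many values and through its exponential partition function. -/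
theorem integral_gaussianTilt_partition [IsProbabilityMeasure P] {X : U → Ω → ℝ}
    (hX : IsGaussianProcess X P) (hm : Measurable fun x : U × Ω => X x.1 x.2)
    (h0 : ∀ u, ∫ ω, X u ω ∂P = 0) {a : U} {ε t : ℝ} {c : U → ℝ} (hc : Measurable c)
    (hcov : Measurable fun u => cov[X u, X a; P])
    (hint : ∀ᵐ ω ∂P, Integrable (fun u => Real.exp (t * X u ω + c u)) μ)
    (hint' : ∀ᵐ ω ∂P,
      Integrable (fun u => Real.exp (t * (X u ω + ε * cov[X u, X a; P]) + c u)) μ)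
    {n : ℕ} (u : Fin n → U) {Φ : (Fin n → ℝ) × ℝ → ℝ} (hΦ : Measurable Φ) :
    ∫ ω, Φ (fun l => X (u l) ω, ∫ u', Real.exp (t * X u' ω + c u') ∂μ)
        * Real.exp (ε * X a ω - ε ^ 2 * Var[X a; P] / 2) ∂P
      = ∫ ω, Φ (fun l => X (u l) ω + ε * cov[X (u l), X a; P],
          ∫ u', Real.exp (t * (X u' ω + ε * cov[X u', X a; P]) + c u') ∂μ) ∂P := by
  have hmu : ∀ u, Measurable (X u) := fun u => hm.comp (measurable_const.prodMk measurable_id)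
  have hae := (ae_tendsto_average (f := fun u ω => Real.exp (t * X u ω + c u))
    ((hm.const_mul t).add (hc.comp measurable_fst)).exp hint).and
    (ae_tendsto_average (f := fun u ω => Real.exp (t * (X u ω + ε * cov[X u, X a; P]) + c u))
    (((hm.add ((hcov.comp measurable_fst).const_mul ε)).const_mul t).add
      (hc.comp measurable_fst)).exp hint')
  -- The two path laws are compared on the product σ-algebra, where an integral over all `u'` is not
  -- visibly measurable. One sample sequence `v`, good for both integrands, replaces it by `Λ`, a
  -- limsup that is measurable in countably many coordinates and is defined on every path.
  obtain ⟨v, hv1, hv2⟩ := hae.exists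
  set Λ : (U → ℝ) → ℝ := fun x => limsup (fun N : ℕ =>
    (∑ i ∈ Finset.range N, Real.exp (t * x (v i) + c (v i))) / N) atTop with hΛ
  have hΛm : Measurable Λ := by
    refine Measurable.limsup fun N => ?_
    fun_prop
  set Ψ : (U → ℝ) → ℝ := fun x => Φ (fun l => x (u l), Λ x) with hΨ
  have hΨm : Measurable Ψ := by
    refine hΦ.comp (Measurable.prodMk ?_ hΛm)
    fun_prop
  have hlaw := map_gaussianTilt_eq_map_add hX hmu h0 a ε
  have hm1 : Measurable (fun ω u => X u ω) := measurable_pi_lambda _ hmu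
  have hm2 : Measurable (fun ω u => X u ω + ε * cov[X u, X a; P]) :=
    measurable_pi_lambda _ fun u => (hmu u).add_const _
  have key : ∫ ω, Ψ (fun u => X u ω) ∂(gaussianTilt P (X a) ε)
      = ∫ ω, Ψ (fun u => X u ω + ε * cov[X u, X a; P]) ∂P := by
    rw [← integral_map hm1.aemeasurable hΨm.aestronglyMeasurable, hlaw,
      integral_map hm2.aemeasurable hΨm.aestronglyMeasurable]
  rw [integral_gaussianTilt (hmu a)] at key
  convert key using 1
  · refine integral_congr_ae ?_
    filter_upwards [hv1] with ω hω
    simp only [hΨ, hΛ, hω.limsup_eq]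
  · refine integral_congr_ae ?_
    filter_upwards [hv2] with ω hω
    simp only [hΨ, hΛ, hω.limsup_eq]

end Sampling

/-! ### Calculus of functions with finite moments of all orders. -/

section AllMoments

variable {α β : Type*} [MeasurableSpace α] [MeasurableSpace β] {μ : Measure α} {ν : Measure β}

/-- `f` has finite absolute moments of all orders. -/
def HasAllMoments (f : α → ℝ) (μ : Measure α) : Prop :=
  ∀ q : ℕ, MemLp f q μ

namespace HasAllMoments

variable {f h : α → ℝ}

lemma integrable (hf : HasAllMoments f μ) : Integrable f μ :=
  memLp_one_iff_integrable.1 (by simpa using hf 1)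

lemma aestronglyMeasurable (hf : HasAllMoments f μ) : AEStronglyMeasurable f μ :=
  (hf 1).aestronglyMeasurable

lemma add (hf : HasAllMoments f μ) (hh : HasAllMoments h μ) :
    HasAllMoments (fun x => f x + h x) μ := fun q => (hf q).add (hh q)

lemma mul (hf : HasAllMoments f μ) (hh : HasAllMoments h μ) :
    HasAllMoments (fun x => f x * h x) μ := fun q => by
  -- Hölder with `1/(2q) + 1/(2q) = 1/q`.
  have : ENNReal.HolderTriple ((2 * q : ℕ) : ENNReal) ((2 * q : ℕ) : ENNReal) (q : ENNReal) := by
    constructor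
    push_cast
    rw [ENNReal.mul_inv (by simp) (by simp), ← add_mul, ENNReal.inv_two_add_inv_two, one_mul]
  exact (hh (2 * q)).mul (hf (2 * q))

lemma sub (hf : HasAllMoments f μ) (hh : HasAllMoments h μ) :
    HasAllMoments (fun x => f x - h x) μ := fun q => (hf q).sub (hh q)

lemma of_bound [IsFiniteMeasure μ] (hf : AEStronglyMeasurable f μ) (C : ℝ)
    (hC : ∀ x, |f x| ≤ C) : HasAllMoments f μ :=
  fun _ => MemLp.of_bound hf C (.of_forall hC)

lemma const [IsFiniteMeasure μ] (c : ℝ) : HasAllMoments (fun _ : α => c) μ :=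
  fun _ => memLp_const c

lemma mono (hh : HasAllMoments h μ) (hf : AEStronglyMeasurable f μ)
    (hle : ∀ᵐ x ∂μ, |f x| ≤ h x) : HasAllMoments f μ :=
  fun q => (hh q).mono hf (hle.mono fun _ hx => hx.trans (le_abs_self _))

lemma abs (hf : HasAllMoments f μ) : HasAllMoments (fun x => |f x|) μ := fun q => (hf q).abs

lemma pow [IsFiniteMeasure μ] (hf : HasAllMoments f μ) (n : ℕ) :
    HasAllMoments (fun x => f x ^ n) μ := by
  induction n with
  | zero => simpa using const 1
  | succ n ih => simpa only [pow_succ] using ih.mul hf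

lemma prod [IsFiniteMeasure μ] {ι : Type*} (S : Finset ι) {f : ι → α → ℝ}
    (hf : ∀ i ∈ S, HasAllMoments (f i) μ) : HasAllMoments (fun x => ∏ i ∈ S, f i x) μ := by
  classical
  induction S using Finset.induction_on with
  | empty => simpa using const 1
  | insert i S hi ih =>
    simp_rw [Finset.prod_insert hi]
    exact (hf i (by simp)).mul (ih fun j hj => hf j (by simp [hj]))

lemma sum [IsFiniteMeasure μ] {ι : Type*} (S : Finset ι) {f : ι → α → ℝ}
    (hf : ∀ i ∈ S, HasAllMoments (f i) μ) : HasAllMoments (fun x => ∑ i ∈ S, f i x) μ :=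
  fun q => memLp_finsetSum S fun i hi => hf i hi q

lemma comp {f : β → ℝ} (hf : HasAllMoments f ν) {φ : α → β} (hφ : MeasurePreserving φ μ ν) :
    HasAllMoments (fun x => f (φ x)) μ := fun q => (hf q).comp_measurePreserving hφ

/-- The `q`-th moment of `exp f` is the integral of `exp (q f)`. For `q = 0` only measurability is
at stake. -/
lemma exp [IsFiniteMeasure μ] (hf : AEStronglyMeasurable f μ)
    (h : ∀ c : ℝ, Integrable (fun x => Real.exp (c * f x)) μ) :
    HasAllMoments (fun x => Real.exp (f x)) μ := fun q => by
  have hm : AEStronglyMeasurable (fun x => Real.exp (f x)) μ :=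
    Real.continuous_exp.comp_aestronglyMeasurable hf
  rcases Nat.eq_zero_or_pos q with rfl | hq
  · simpa using hm
  · rw [← integrable_norm_rpow_iff hm (by simpa using hq.ne') (by simp)]
    refine (h q).congr (.of_forall fun x => ?_)
    simp only [Real.norm_eq_abs, Real.abs_exp, ENNReal.toReal_natCast, Real.rpow_natCast]
    rw [← Real.exp_nat_mul]

end HasAllMoments

end AllMoments

/-! ### The Gibbs weight, its partition function and moment bounds. -/

section Gibbs

variable {Ω : Type*}

/-- The Gibbs weight `𝔼_z exp (t G_p)` of the replica `u`. -/
def gibbsWeight (s : I → I → I → ℝ) (p : ℕ) (g : I → I → Ω → ℝ) (t : ℝ) (w u : I) (ω : Ω) : ℝ :=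
  Real.exp (t * g w u ω + t ^ 2 * (1 - overlap s w u u ^ p) / 2)

/-- The partition function `𝔼' exp (t G_p)`. -/
def partitionFn (s : I → I → I → ℝ) (p : ℕ) (g : I → I → Ω → ℝ) (t : ℝ) (w : I) (ω : Ω) : ℝ :=
  ∫ u : I, gibbsWeight s p g t w u ω

/-- The reference measure for the environment `(w, ω)` and `n` replicas. -/
def replicaMeasure [MeasurableSpace Ω] (P : Measure Ω) (n : ℕ) : Measure ((I × Ω) × (Fin n → I)) :=
  ((volume : Measure I).prod P).prod volume

/-- The density of `n` replicas sampled from the Gibbs measure. -/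
def gibbsDensity (s : I → I → I → ℝ) (p : ℕ) (g : I → I → Ω → ℝ) (t : ℝ) (n : ℕ)
    (x : (I × Ω) × (Fin n → I)) : ℝ :=
  (∏ l, gibbsWeight s p g t x.1.1 (x.2 l) x.1.2) / partitionFn s p g t x.1.1 x.1.2 ^ n

variable {s : I → I → I → ℝ} {p : ℕ} {g : I → I → Ω → ℝ} {t : ℝ}

instance [MeasurableSpace Ω] (P : Measure Ω) [IsProbabilityMeasure P] (n : ℕ) :
    IsProbabilityMeasure (replicaMeasure P n) := by
  unfold replicaMeasure; infer_instance

lemma measurable_overlap (hs : Measurable fun x : I × I × I => s x.1 x.2.1 x.2.2) :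
    Measurable fun x : I × I × I => overlap s x.1 x.2.1 x.2.2 := by
  have : Measurable fun x : (I × I × I) × I =>
      s x.1.1 x.1.2.1 x.2 * s x.1.1 x.1.2.2 x.2 :=
    (hs.comp (g := fun x : I × I × I => s x.1 x.2.1 x.2.2)
      (f := fun x : (I × I × I) × I => (x.1.1, x.1.2.1, x.2)) (by fun_prop)).mul
    (hs.comp (g := fun x : I × I × I => s x.1 x.2.1 x.2.2)
      (f := fun x : (I × I × I) × I => (x.1.1, x.1.2.2, x.2)) (by fun_prop))
  exact this.stronglyMeasurable.integral_prod_right'.measurable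

lemma abs_multiOverlap_le_one {ι : Type*} (hs : ∀ w u v, s w u v ∈ Set.Icc (-1 : ℝ) 1) (w : I)
    (u : ι → I) (S : Finset ι) : |multiOverlap s w u S| ≤ 1 := by
  have h := norm_integral_le_of_norm_le_const (μ := (volume : Measure I)) (C := 1)
    (f := fun v => ∏ l ∈ S, s w (u l) v) (.of_forall fun v => by
      rw [Real.norm_eq_abs, Finset.abs_prod]
      exact Finset.prod_le_one (fun _ _ => abs_nonneg _) fun l _ => abs_le.2 (hs _ _ _))
  simpa [multiOverlap] using h

lemma overlap_eq_multiOverlap {ι : Type*} (w : I) (u : ι → I) {i j : ι}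
    (hij : i ≠ j) [DecidableEq ι] :
    overlap s w (u i) (u j) = multiOverlap s w u {i, j} := by
  simp only [overlap, multiOverlap, Finset.prod_pair hij]

lemma abs_overlap_le_one (hs : ∀ w u v, s w u v ∈ Set.Icc (-1 : ℝ) 1) (w u u' : I) :
    |overlap s w u u'| ≤ 1 := by
  have := overlap_eq_multiOverlap (s := s) w ![u, u'] (i := 0) (j := 1) (by simp)
  simp only [Matrix.cons_val_zero, Matrix.cons_val_one] at this
  rw [this]
  exact abs_multiOverlap_le_one hs _ _ _

lemma abs_overlap_pow_le_one (hs : ∀ w u v, s w u v ∈ Set.Icc (-1 : ℝ) 1) (p : ℕ) (w u u' : I) :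
    |overlap s w u u' ^ p| ≤ 1 := by
  rw [abs_pow]
  exact pow_le_one₀ (abs_nonneg _) (abs_overlap_le_one hs w u u')

lemma overlap_self_nonneg (w u : I) : 0 ≤ overlap s w u u :=
  integral_nonneg fun _ => mul_self_nonneg _

lemma overlap_comm (w u u' : I) : overlap s w u u' = overlap s w u' u := by
  simp only [overlap, mul_comm]

lemma overlap_self_pow_le_one (hs : ∀ w u v, s w u v ∈ Set.Icc (-1 : ℝ) 1) (p : ℕ) (w u : I) :
    overlap s w u u ^ p ≤ 1 := (abs_le.1 (abs_overlap_pow_le_one hs p w u u)).2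

lemma gibbsWeight_pos (w u : I) (ω : Ω) : 0 < gibbsWeight s p g t w u ω := Real.exp_pos _

lemma partitionFn_nonneg (w : I) (ω : Ω) : 0 ≤ partitionFn s p g t w ω :=
  integral_nonneg fun _ => (gibbsWeight_pos _ _ _).le

lemma gibbsDensity_nonneg {n : ℕ} (x : (I × Ω) × (Fin n → I)) : 0 ≤ gibbsDensity s p g t n x :=
  div_nonneg (Finset.prod_nonneg fun _ _ => (gibbsWeight_pos _ _ _).le)
    (pow_nonneg (partitionFn_nonneg _ _) _)

/-- The power of the self-overlap lies in `[0, 1]`, so integrating out `z` contributes a factor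
between `1` and `exp (t² / 2)`. This lemma and `exp_le_gibbsWeight` are the two sides. -/
lemma gibbsWeight_le (w u : I) (ω : Ω) :
    gibbsWeight s p g t w u ω ≤ Real.exp (t ^ 2 / 2) * Real.exp (t * g w u ω) := by
  rw [gibbsWeight, ← Real.exp_add, add_comm]
  gcongr
  exact mul_le_of_le_one_right (sq_nonneg t)
    (by linarith [pow_nonneg (overlap_self_nonneg (s := s) w u) p])

lemma exp_le_gibbsWeight (hs : ∀ w u v, s w u v ∈ Set.Icc (-1 : ℝ) 1) (w u : I) (ω : Ω) :
    Real.exp (t * g w u ω) ≤ gibbsWeight s p g t w u ω := by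
  rw [gibbsWeight]
  gcongr
  have := overlap_self_pow_le_one hs p w u
  have : 0 ≤ t ^ 2 * (1 - overlap s w u u ^ p) / 2 := by
    have := mul_nonneg (sq_nonneg t) (sub_nonneg.2 this)
    positivity
  linarith

variable [MeasurableSpace Ω]

lemma measurable_gibbsWeight (hs : Measurable fun x : I × I × I => s x.1 x.2.1 x.2.2)
    (hg : Measurable fun x : I × I × Ω => g x.1 x.2.1 x.2.2) :
    Measurable fun x : I × I × Ω => gibbsWeight s p g t x.1 x.2.1 x.2.2 := by
  have h1 : Measurable fun x : I × I × Ω => overlap s x.1 x.2.1 x.2.1 :=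
    (measurable_overlap hs).comp (g := fun x : I × I × I => overlap s x.1 x.2.1 x.2.2)
      (f := fun x : I × I × Ω => (x.1, x.2.1, x.2.1)) (by fun_prop)
  unfold gibbsWeight
  fun_prop

lemma measurable_partitionFn (hs : Measurable fun x : I × I × I => s x.1 x.2.1 x.2.2)
    (hg : Measurable fun x : I × I × Ω => g x.1 x.2.1 x.2.2) :
    Measurable fun x : I × Ω => partitionFn s p g t x.1 x.2 := by
  have : Measurable fun x : (I × Ω) × I => gibbsWeight s p g t x.1.1 x.2 x.1.2 :=
    (measurable_gibbsWeight hs hg).comp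
      (g := fun x : I × I × Ω => gibbsWeight s p g t x.1 x.2.1 x.2.2)
      (f := fun x : (I × Ω) × I => (x.1.1, x.2, x.1.2)) (by fun_prop)
  exact this.stronglyMeasurable.integral_prod_right'.measurable

lemma measurable_gibbsDensity (hs : Measurable fun x : I × I × I => s x.1 x.2.1 x.2.2)
    (hg : Measurable fun x : I × I × Ω => g x.1 x.2.1 x.2.2) (n : ℕ) :
    Measurable (gibbsDensity s p g t n) := by
  refine Measurable.div ?_ (((measurable_partitionFn hs hg).comp measurable_fst).pow_const n)
  refine Finset.measurable_fun_prod _ fun l _ => ?_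
  exact (measurable_gibbsWeight hs hg).comp
      (g := fun x : I × I × Ω => gibbsWeight s p g t x.1 x.2.1 x.2.2)
      (f := fun x : (I × Ω) × (Fin n → I) => (x.1.1, x.2 l, x.1.2)) (by fun_prop)

variable {P : Measure Ω}

namespace IsOverlapGaussianProcess

lemma variance_eq (hg : IsOverlapGaussianProcess P s p g) (w u : I) :
    Var[g w u; P] = overlap s w u u ^ p := by
  have := (hg.isGaussianProcess w).aemeasurable u
  rw [← covariance_self this, hg.covariance_eq]

lemma measurable_apply (hg : IsOverlapGaussianProcess P s p g) {α : Type*}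
    [MeasurableSpace α] {f₁ f₂ : α → I} {f₃ : α → Ω}
    (h₁ : Measurable f₁) (h₂ : Measurable f₂) (h₃ : Measurable f₃) :
    Measurable fun x => g (f₁ x) (f₂ x) (f₃ x) :=
  hg.measurable.comp (g := fun x : I × I × Ω => g x.1 x.2.1 x.2.2)
    (f := fun x => (f₁ x, f₂ x, f₃ x)) (by fun_prop)

lemma measurable_replica (hg : IsOverlapGaussianProcess P s p g) {n : ℕ} (l : Fin n) :
    Measurable fun x : (I × Ω) × (Fin n → I) => g x.1.1 (x.2 l) x.1.2 :=
  hg.measurable_apply (by fun_prop) (by fun_prop) (by fun_prop)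

variable [IsProbabilityMeasure P]

/-- Each `g w u` is centered Gaussian with variance at most 1, so its exponential moment is at most
`exp (c² / 2)` uniformly in `w` and `u`. Tonelli concludes. -/
lemma integrable_exp (hg : IsOverlapGaussianProcess P s p g)
    (hs : ∀ w u v, s w u v ∈ Set.Icc (-1 : ℝ) 1) (c : ℝ) :
    Integrable (fun x : (I × Ω) × I => Real.exp (c * g x.1.1 x.2 x.1.2))
      (((volume : Measure I).prod P).prod volume) := by
  have hm : Measurable fun x : (I × Ω) × I => Real.exp (c * g x.1.1 x.2 x.1.2) :=
    ((hg.measurable_apply (by fun_prop) (by fun_prop) (by fun_prop)).const_mul c).exp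
  refine ⟨hm.aestronglyMeasurable, ?_⟩
  rw [hasFiniteIntegral_iff_ofReal (.of_forall fun _ => (Real.exp_pos _).le)]
  rw [lintegral_prod_symm' _ (by fun_prop)]
  have hbd : ∀ w u, ∫⁻ ω, ENNReal.ofReal (Real.exp (c * g w u ω)) ∂P
      ≤ ENNReal.ofReal (Real.exp (c ^ 2 / 2)) := fun w u => by
    have hG := (hg.isGaussianProcess w).hasGaussianLaw_eval u
    rw [← ofReal_integral_eq_lintegral_ofReal
      (integrable_exp_of_hasGaussianLaw hG (hg.mean_eq_zero w u) c)
      (.of_forall fun _ => (Real.exp_pos _).le)]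
    have h := mgf_eq_of_hasGaussianLaw hG (hg.mean_eq_zero w u) c
    rw [mgf] at h
    rw [h, hg.variance_eq]
    gcongr
    exact mul_le_of_le_one_right (sq_nonneg c) (overlap_self_pow_le_one hs p w u)
  calc _ ≤ ∫⁻ _ : I, ENNReal.ofReal (Real.exp (c ^ 2 / 2)) := by
        refine lintegral_mono fun u => ?_
        have hmu : Measurable fun x : I × Ω => ENNReal.ofReal (Real.exp (c * g x.1 u x.2)) := by
          have := hg.measurable_apply (α := I × Ω) measurable_fst
            (measurable_const (a := u)) measurable_snd
          fun_prop
        dsimp only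
        rw [lintegral_prod _ hmu.aemeasurable]
        calc _ ≤ ∫⁻ _ : I, ENNReal.ofReal (Real.exp (c ^ 2 / 2)) :=
              lintegral_mono fun w => hbd w u
          _ = _ := by simp
    _ < ⊤ := by simp

lemma hasAllMoments_exp (hg : IsOverlapGaussianProcess P s p g)
    (hs : ∀ w u v, s w u v ∈ Set.Icc (-1 : ℝ) 1) (c : ℝ) :
    HasAllMoments (fun x : (I × Ω) × I => Real.exp (c * g x.1.1 x.2 x.1.2))
      (((volume : Measure I).prod P).prod volume) := by
  refine HasAllMoments.exp ?_ fun c' => ?_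
  · exact ((hg.measurable_apply (by fun_prop) (by fun_prop)
      (by fun_prop)).const_mul c).aestronglyMeasurable
  · simpa only [← mul_assoc] using hg.integrable_exp hs (c' * c)


lemma hasAllMoments_exp_replica (hg : IsOverlapGaussianProcess P s p g)
    (hs : ∀ w u v, s w u v ∈ Set.Icc (-1 : ℝ) 1) (c : ℝ) {n : ℕ} (l : Fin n) :
    HasAllMoments (fun x => Real.exp (c * g x.1.1 (x.2 l) x.1.2)) (replicaMeasure P n) :=
  (hg.hasAllMoments_exp hs c).comp
    ((MeasurePreserving.id _).prod (measurePreserving_eval (fun _ : Fin n => (volume : Measure I)) l))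

lemma hasAllMoments_exp_abs (hg : IsOverlapGaussianProcess P s p g)
    (hs : ∀ w u v, s w u v ∈ Set.Icc (-1 : ℝ) 1) {n : ℕ} (l : Fin n) :
    HasAllMoments (fun x => Real.exp |g x.1.1 (x.2 l) x.1.2|) (replicaMeasure P n) := by
  refine ((hg.hasAllMoments_exp_replica hs 1 l).add (hg.hasAllMoments_exp_replica hs (-1) l)).mono
    ?_ (.of_forall fun x => ?_)
  · have := hg.measurable_replica l
    exact (measurable_norm.comp this).exp.aestronglyMeasurable
  · rw [Real.abs_exp]
    simpa using Real.exp_abs_le (g x.1.1 (x.2 l) x.1.2)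

lemma hasAllMoments_replica (hg : IsOverlapGaussianProcess P s p g)
    (hs : ∀ w u v, s w u v ∈ Set.Icc (-1 : ℝ) 1) {n : ℕ} (l : Fin n) :
    HasAllMoments (fun x => g x.1.1 (x.2 l) x.1.2) (replicaMeasure P n) :=
  (hg.hasAllMoments_exp_abs hs l).mono (hg.measurable_replica l).aestronglyMeasurable
    (.of_forall fun x => by linarith [Real.add_one_le_exp |g x.1.1 (x.2 l) x.1.2|])

lemma hasAllMoments_gibbsWeight (hg : IsOverlapGaussianProcess P s p g)
    (hsm : Measurable fun x : I × I × I => s x.1 x.2.1 x.2.2)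
    (hs : ∀ w u v, s w u v ∈ Set.Icc (-1 : ℝ) 1) {n : ℕ} (l : Fin n) :
    HasAllMoments (fun x => gibbsWeight s p g t x.1.1 (x.2 l) x.1.2) (replicaMeasure P n) := by
  refine ((HasAllMoments.const (Real.exp (t ^ 2 / 2))).mul
    (hg.hasAllMoments_exp_replica hs t l)).mono ?_ (.of_forall fun x => ?_)
  · exact ((measurable_gibbsWeight hsm hg.measurable).comp
      (g := fun x : I × I × Ω => gibbsWeight s p g t x.1 x.2.1 x.2.2)
      (f := fun x : (I × Ω) × (Fin n → I) => (x.1.1, x.2 l, x.1.2))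
      (by fun_prop)).aestronglyMeasurable
  · rw [abs_of_pos (gibbsWeight_pos _ _ _)]
    exact gibbsWeight_le _ _ _

lemma integrable_gibbsWeight (hg : IsOverlapGaussianProcess P s p g)
    (hsm : Measurable fun x : I × I × I => s x.1 x.2.1 x.2.2)
    (hs : ∀ w u v, s w u v ∈ Set.Icc (-1 : ℝ) 1) :
    ∀ᵐ y ∂((volume : Measure I).prod P),
      Integrable fun u : I => gibbsWeight s p g t y.1 u y.2 := by
  have h := (((hg.integrable_exp hs t).const_mul (Real.exp (t ^ 2 / 2))).mono'
    (g := fun _ => _) (f := fun x : (I × Ω) × I => gibbsWeight s p g t x.1.1 x.2 x.1.2)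
    ((measurable_gibbsWeight hsm hg.measurable).comp
      (g := fun x : I × I × Ω => gibbsWeight s p g t x.1 x.2.1 x.2.2)
      (f := fun x : (I × Ω) × I => (x.1.1, x.2, x.1.2)) (by fun_prop)).aestronglyMeasurable
    (.of_forall fun x => by
      rw [Real.norm_eq_abs, abs_of_pos (gibbsWeight_pos _ _ _)]
      exact gibbsWeight_le _ _ _))
  exact h.prod_right_ae

lemma partitionFn_pos (hg : IsOverlapGaussianProcess P s p g)
    (hsm : Measurable fun x : I × I × I => s x.1 x.2.1 x.2.2)
    (hs : ∀ w u v, s w u v ∈ Set.Icc (-1 : ℝ) 1) :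
    ∀ᵐ y ∂((volume : Measure I).prod P), 0 < partitionFn s p g t y.1 y.2 := by
  filter_upwards [hg.integrable_gibbsWeight (t := t) hsm hs] with y hy
  exact integral_exp_pos hy

/-- Jensen is applied twice. First, the partition function is at least `∫ exp (t g) ≥ exp (t ∫ g)`,
so its inverse is at most `exp (-t ∫ g)`. Then the moments of this bound are controlled by `∫ exp
(-c t g)`. -/
lemma hasAllMoments_inv_partitionFn (hg : IsOverlapGaussianProcess P s p g)
    (hsm : Measurable fun x : I × I × I => s x.1 x.2.1 x.2.2)
    (hs : ∀ w u v, s w u v ∈ Set.Icc (-1 : ℝ) 1) :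
    HasAllMoments (fun y : I × Ω => (partitionFn s p g t y.1 y.2)⁻¹)
      ((volume : Measure I).prod P) := by
  have hgint : ∀ᵐ y ∂((volume : Measure I).prod P), Integrable fun u : I => g y.1 u y.2 := by
    have h1 := (hg.integrable_exp hs 1).prod_right_ae
    have h2 := (hg.integrable_exp hs (-1)).prod_right_ae
    filter_upwards [h1, h2] with y hy1 hy2
    refine (hy1.add hy2).mono' (hg.measurable_apply measurable_const measurable_id
      measurable_const).aestronglyMeasurable (.of_forall fun u => ?_)
    have := Real.exp_abs_le (g y.1 u y.2)
    have := Real.add_one_le_exp |g y.1 u y.2|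
    simp only [Real.norm_eq_abs, Pi.add_apply, one_mul, neg_mul]
    linarith
  have hYm : Measurable fun y : I × Ω => ∫ u : I, g y.1 u y.2 :=
    (hg.measurable_apply (f₁ := fun x : (I × Ω) × I => x.1.1) (f₂ := fun x => x.2)
      (f₃ := fun x => x.1.2) (by fun_prop) (by fun_prop) (by fun_prop)).stronglyMeasurable.integral_prod_right'.measurable
  have hjensen : ∀ c : ℝ, ∀ᵐ y ∂((volume : Measure I).prod P),
      Real.exp (c * ∫ u : I, g y.1 u y.2) ≤ ∫ u : I, Real.exp (c * g y.1 u y.2) := fun c => by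
    filter_upwards [hgint, (hg.integrable_exp hs c).prod_right_ae] with y hy1 hy2
    rw [← integral_const_mul]
    exact convexOn_exp.map_integral_le Real.continuous_exp.continuousOn isClosed_univ (by simp)
      (hy1.const_mul c) hy2
  have hexp : HasAllMoments (fun y : I × Ω => Real.exp (-t * ∫ u : I, g y.1 u y.2))
      ((volume : Measure I).prod P) := by
    refine HasAllMoments.exp (hYm.const_mul _).aestronglyMeasurable fun c => ?_
    refine (hg.integrable_exp hs (c * -t)).integral_prod_left.mono'
      ((hYm.const_mul _).const_mul _).exp.aestronglyMeasurable ?_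
    filter_upwards [hjensen (c * -t)] with y hy
    rw [Real.norm_eq_abs, Real.abs_exp, ← mul_assoc]
    exact hy
  refine hexp.mono (measurable_partitionFn hsm hg.measurable).inv.aestronglyMeasurable ?_
  filter_upwards [hjensen t, hg.integrable_gibbsWeight (t := t) hsm hs,
    (hg.integrable_exp hs t).prod_right_ae] with y hy1 hy2 hy3
  rw [abs_of_nonneg (inv_nonneg.2 (partitionFn_nonneg _ _)), neg_mul, Real.exp_neg]
  refine inv_anti₀ (Real.exp_pos _) (hy1.trans ?_)
  exact integral_mono hy3 hy2 fun u => exp_le_gibbsWeight hs _ _ _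

lemma hasAllMoments_gibbsDensity (hg : IsOverlapGaussianProcess P s p g)
    (hsm : Measurable fun x : I × I × I => s x.1 x.2.1 x.2.2)
    (hs : ∀ w u v, s w u v ∈ Set.Icc (-1 : ℝ) 1) (n : ℕ) :
    HasAllMoments (gibbsDensity s p g t n) (replicaMeasure P n) := by
  have h := (HasAllMoments.prod Finset.univ fun l _ =>
    hg.hasAllMoments_gibbsWeight (t := t) hsm hs (n := n) l).mul
    (((hg.hasAllMoments_inv_partitionFn (t := t) hsm hs).pow n).comp
      (measurePreserving_fst (ν := (volume : Measure (Fin n → I)))))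
  simp_rw [inv_pow, ← div_eq_mul_inv] at h
  exact h

end IsOverlapGaussianProcess

end Gibbs

/-! ### The Gibbs density along a Cameron-Martin shift, and its derivative in `ε`. -/

section ShiftedGibbs

variable {Ω : Type*} {s : I → I → I → ℝ} {p : ℕ} {g : I → I → Ω → ℝ} {t : ℝ}

/-- The partition function of the Gibbs measure whose process is shifted by `ε` times its
covariance with the value at `a`. -/
def shiftedPartition (s : I → I → I → ℝ) (p : ℕ) (g : I → I → Ω → ℝ) (t ε : ℝ) (w a : I) (ω : Ω) :
    ℝ :=
  ∫ u : I, gibbsWeight s p g t w u ω * Real.exp (ε * (t * overlap s w u a ^ p))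

/-- The density of `n + 1` replicas under the Gibbs measure whose process is shifted by `ε` times
its covariance with the value at the first replica. -/
def shiftedDensity (s : I → I → I → ℝ) (p : ℕ) (g : I → I → Ω → ℝ) (t ε : ℝ) (n : ℕ)
    (x : (I × Ω) × (Fin (n + 1) → I)) : ℝ :=
  (∏ l, (gibbsWeight s p g t x.1.1 (x.2 l) x.1.2
      * Real.exp (ε * (t * overlap s x.1.1 (x.2 l) (x.2 0) ^ p))))
    / shiftedPartition s p g t ε x.1.1 (x.2 0) x.1.2 ^ (n + 1)

/-- The Gibbs average of the covariance with the value at `a`, for the shifted process. -/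
def shiftedMean (s : I → I → I → ℝ) (p : ℕ) (g : I → I → Ω → ℝ) (t ε : ℝ) (w a : I) (ω : Ω) : ℝ :=
  (∫ u : I, overlap s w u a ^ p
      * (gibbsWeight s p g t w u ω * Real.exp (ε * (t * overlap s w u a ^ p))))
    / shiftedPartition s p g t ε w a ω

lemma shiftedDensity_zero (n : ℕ) (x : (I × Ω) × (Fin (n + 1) → I)) :
    shiftedDensity s p g t 0 n x = gibbsDensity s p g t (n + 1) x := by
  simp [shiftedDensity, gibbsDensity, shiftedPartition, partitionFn]

/-- Restricting to `|ε| ≤ 1` gives bounds free of `ε`, `w` and the replicas; all dominations below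
rest on them. -/
lemma exp_mul_overlap_mem (hs : ∀ w u v, s w u v ∈ Set.Icc (-1 : ℝ) 1) {ε : ℝ} (hε : |ε| ≤ 1)
    (w u a : I) : Real.exp (ε * (t * overlap s w u a ^ p)) ∈
      Set.Icc (Real.exp (-|t|)) (Real.exp |t|) := by
  have h : |ε * (t * overlap s w u a ^ p)| ≤ |t| := by
    rw [abs_mul, abs_mul]
    calc |ε| * (|t| * |overlap s w u a ^ p|) ≤ 1 * (|t| * 1) := by
          gcongr
          exact abs_overlap_pow_le_one hs p w u a
      _ = |t| := by ring
  exact ⟨Real.exp_le_exp.2 (abs_le.1 h).1, Real.exp_le_exp.2 (abs_le.1 h).2⟩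

lemma measurable_overlap_comp (hsm : Measurable fun x : I × I × I => s x.1 x.2.1 x.2.2)
    {α : Type*} [MeasurableSpace α] {f₁ f₂ f₃ : α → I} (h₁ : Measurable f₁) (h₂ : Measurable f₂)
    (h₃ : Measurable f₃) : Measurable fun x => overlap s (f₁ x) (f₂ x) (f₃ x) :=
  (measurable_overlap hsm).comp (g := fun x : I × I × I => overlap s x.1 x.2.1 x.2.2)
    (f := fun x => (f₁ x, f₂ x, f₃ x)) (by fun_prop)

section Pointwise

variable {w : I} {ω : Ω}

lemma integrable_shiftedWeight (hint : Integrable fun u : I => gibbsWeight s p g t w u ω)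
    (hsm : Measurable fun x : I × I × I => s x.1 x.2.1 x.2.2)
    (hs : ∀ w u v, s w u v ∈ Set.Icc (-1 : ℝ) 1) (a : I) {ε : ℝ} (hε : |ε| ≤ 1) :
    Integrable fun u : I => gibbsWeight s p g t w u ω * Real.exp (ε * (t * overlap s w u a ^ p)) :=
  hint.mul_bdd (c := Real.exp |t|)
    ((((measurable_overlap_comp hsm measurable_const measurable_id
      measurable_const).pow_const p).const_mul t).const_mul ε).exp.aestronglyMeasurable
    (.of_forall fun u => by
      rw [Real.norm_eq_abs, Real.abs_exp]
      exact (exp_mul_overlap_mem hs hε w u a).2)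

lemma exp_mul_partitionFn_le (hint : Integrable fun u : I => gibbsWeight s p g t w u ω)
    (hsm : Measurable fun x : I × I × I => s x.1 x.2.1 x.2.2)
    (hs : ∀ w u v, s w u v ∈ Set.Icc (-1 : ℝ) 1) (a : I) {ε : ℝ} (hε : |ε| ≤ 1) :
    Real.exp (-|t|) * partitionFn s p g t w ω ≤ shiftedPartition s p g t ε w a ω := by
  rw [partitionFn, shiftedPartition, ← integral_const_mul]
  refine integral_mono (hint.const_mul _) (integrable_shiftedWeight hint hsm hs a hε) fun u => ?_
  dsimp only
  rw [mul_comm]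
  exact mul_le_mul_of_nonneg_left (exp_mul_overlap_mem hs hε w u a).1 (gibbsWeight_pos _ _ _).le

lemma partitionFn_pos_of_integrable (hint : Integrable fun u : I => gibbsWeight s p g t w u ω) :
    0 < partitionFn s p g t w ω := integral_exp_pos hint

lemma shiftedPartition_pos (hint : Integrable fun u : I => gibbsWeight s p g t w u ω)
    (hsm : Measurable fun x : I × I × I => s x.1 x.2.1 x.2.2)
    (hs : ∀ w u v, s w u v ∈ Set.Icc (-1 : ℝ) 1) (a : I) {ε : ℝ} (hε : |ε| ≤ 1) :
    0 < shiftedPartition s p g t ε w a ω :=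
  (mul_pos (Real.exp_pos _) (partitionFn_pos_of_integrable hint)).trans_le
    (exp_mul_partitionFn_le hint hsm hs a hε)

lemma abs_shiftedMean_le_one (hint : Integrable fun u : I => gibbsWeight s p g t w u ω)
    (hsm : Measurable fun x : I × I × I => s x.1 x.2.1 x.2.2)
    (hs : ∀ w u v, s w u v ∈ Set.Icc (-1 : ℝ) 1) (a : I) {ε : ℝ} (hε : |ε| ≤ 1) :
    |shiftedMean s p g t ε w a ω| ≤ 1 := by
  have hpos := shiftedPartition_pos hint hsm hs a hε
  rw [shiftedMean, abs_div, abs_of_pos hpos, div_le_one hpos, ← Real.norm_eq_abs]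
  refine norm_integral_le_of_norm_le (integrable_shiftedWeight hint hsm hs a hε)
    (.of_forall fun u => ?_)
  rw [norm_mul, Real.norm_eq_abs, Real.norm_eq_abs,
    abs_of_pos (mul_pos (gibbsWeight_pos (s := s) (p := p) (g := g) (t := t) w u ω)
      (Real.exp_pos (ε * (t * overlap s w u a ^ p))))]
  exact mul_le_of_le_one_left (mul_pos (gibbsWeight_pos _ _ _) (Real.exp_pos _)).le
    (abs_overlap_pow_le_one hs p w u a)

/-- The derivative is written as a logarithmic derivative, `t` times the Gibbs mean of the
covariance, so that it combines with that of the numerator in `hasDerivAt_shiftedDensity`. -/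
lemma hasDerivAt_shiftedPartition (hint : Integrable fun u : I => gibbsWeight s p g t w u ω)
    (hsm : Measurable fun x : I × I × I => s x.1 x.2.1 x.2.2)
    (hs : ∀ w u v, s w u v ∈ Set.Icc (-1 : ℝ) 1) (a : I) {ε : ℝ} (hε : |ε| < 1) :
    HasDerivAt (fun ε => shiftedPartition s p g t ε w a ω)
      (t * shiftedMean s p g t ε w a ω * shiftedPartition s p g t ε w a ω) ε := by
  have hm : ∀ ε : ℝ, AEStronglyMeasurable
      (fun u => Real.exp (ε * (t * overlap s w u a ^ p))) volume := fun ε =>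
    ((((measurable_overlap_comp hsm measurable_const measurable_id
      measurable_const).pow_const p).const_mul t).const_mul ε).exp.aestronglyMeasurable
  have hm' : AEStronglyMeasurable (fun u => t * overlap s w u a ^ p) volume :=
    (((measurable_overlap_comp hsm measurable_const measurable_id
      measurable_const).pow_const p).const_mul t).aestronglyMeasurable
  have hball : Metric.ball (0 : ℝ) 1 ∈ nhds ε :=
    Metric.isOpen_ball.mem_nhds (by simpa using hε)
  have h := (hasDerivAt_integral_of_dominated_loc_of_deriv_le (μ := (volume : Measure I))
    (F := fun ε u => gibbsWeight s p g t w u ω * Real.exp (ε * (t * overlap s w u a ^ p)))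
    (F' := fun ε u => gibbsWeight s p g t w u ω
      * (Real.exp (ε * (t * overlap s w u a ^ p)) * (t * overlap s w u a ^ p)))
    (bound := fun u => gibbsWeight s p g t w u ω * (Real.exp |t| * |t|)) hball
    (.of_forall fun ε => hint.aestronglyMeasurable.mul (hm ε))
    (integrable_shiftedWeight hint hsm hs a hε.le)
    (hint.aestronglyMeasurable.mul ((hm ε).mul hm')) (.of_forall fun u x hx => ?_)
    (hint.mul_const _) (.of_forall fun u x hx => ?_)).2
  · have h' : HasDerivAt (fun ε => shiftedPartition s p g t ε w a ω) _ ε := h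
    refine h'.congr_deriv ?_
    symm
    rw [mul_assoc, shiftedMean, div_mul_cancel₀ _ (shiftedPartition_pos hint hsm hs a hε.le).ne',
      ← integral_const_mul]
    refine integral_congr_ae (.of_forall fun u => ?_)
    dsimp only
    ring
  · have hx' : |x| ≤ 1 := by simpa using (Metric.mem_ball.1 hx).le
    rw [norm_mul, norm_mul, Real.norm_eq_abs, Real.norm_eq_abs, Real.norm_eq_abs,
      abs_of_pos (gibbsWeight_pos _ _ _), Real.abs_exp, abs_mul]
    refine mul_le_mul_of_nonneg_left ?_ (gibbsWeight_pos _ _ _).le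
    exact mul_le_mul (exp_mul_overlap_mem hs hx' w u a).2
      (mul_le_of_le_one_right (abs_nonneg t) (abs_overlap_pow_le_one hs p w u a))
      (by positivity) (by positivity)
  · have := ((hasDerivAt_id x).mul_const (t * overlap s w u a ^ p)).exp.const_mul
      (gibbsWeight s p g t w u ω)
    simpa using this

lemma shiftedDensity_nonneg {ε : ℝ} {n : ℕ} (x : (I × Ω) × (Fin (n + 1) → I)) :
    0 ≤ shiftedDensity s p g t ε n x :=
  div_nonneg (Finset.prod_nonneg fun _ _ =>
      mul_nonneg (gibbsWeight_pos _ _ _).le (Real.exp_pos _).le)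
    (pow_nonneg (integral_nonneg fun _ =>
      mul_nonneg (gibbsWeight_pos _ _ _).le (Real.exp_pos _).le) _)

/-- Each replica costs `exp |t|` in the numerator and another `exp |t|` through the partition
function. -/
lemma shiftedDensity_le (hint : Integrable fun u : I => gibbsWeight s p g t w u ω)
    (hsm : Measurable fun x : I × I × I => s x.1 x.2.1 x.2.2)
    (hs : ∀ w u v, s w u v ∈ Set.Icc (-1 : ℝ) 1) {ε : ℝ} (hε : |ε| ≤ 1) {n : ℕ}
    (u : Fin (n + 1) → I) :
    shiftedDensity s p g t ε n ((w, ω), u)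
      ≤ Real.exp (2 * |t|) ^ (n + 1) * gibbsDensity s p g t (n + 1) ((w, ω), u) := by
  have hZ := partitionFn_pos_of_integrable hint
  have h1 : ∏ l, (gibbsWeight s p g t w (u l) ω
        * Real.exp (ε * (t * overlap s w (u l) (u 0) ^ p)))
      ≤ Real.exp |t| ^ (n + 1) * ∏ l, gibbsWeight s p g t w (u l) ω := by
    rw [Finset.prod_mul_distrib, mul_comm]
    refine mul_le_mul_of_nonneg_right ?_
      (Finset.prod_nonneg fun _ _ => (gibbsWeight_pos _ _ _).le)
    calc _ ≤ ∏ _l : Fin (n + 1), Real.exp |t| :=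
          Finset.prod_le_prod (fun _ _ => (Real.exp_pos _).le)
            fun l _ => (exp_mul_overlap_mem hs hε w (u l) (u 0)).2
      _ = _ := by simp
  have h2 := exp_mul_partitionFn_le hint hsm hs (u 0) hε
  calc shiftedDensity s p g t ε n ((w, ω), u)
      ≤ (Real.exp |t| ^ (n + 1) * ∏ l, gibbsWeight s p g t w (u l) ω)
          / (Real.exp (-|t|) * partitionFn s p g t w ω) ^ (n + 1) := by
        refine div_le_div₀ ?_ h1 (by positivity) (by gcongr)
        exact mul_nonneg (by positivity)
          (Finset.prod_nonneg fun _ _ => (gibbsWeight_pos _ _ _).le)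
    _ = _ := by
        rw [gibbsDensity, mul_pow, mul_div_mul_comm, ← div_pow, ← Real.exp_sub]
        congr 3
        ring

lemma hasDerivAt_shiftedDensity (hint : Integrable fun u : I => gibbsWeight s p g t w u ω)
    (hsm : Measurable fun x : I × I × I => s x.1 x.2.1 x.2.2)
    (hs : ∀ w u v, s w u v ∈ Set.Icc (-1 : ℝ) 1) {ε : ℝ} (hε : |ε| < 1) {n : ℕ}
    (u : Fin (n + 1) → I) :
    HasDerivAt (fun ε => shiftedDensity s p g t ε n ((w, ω), u))
      (shiftedDensity s p g t ε n ((w, ω), u) *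
        (t * (∑ l, overlap s w (u l) (u 0) ^ p - (n + 1) * shiftedMean s p g t ε w (u 0) ω))) ε := by
  have hpos := shiftedPartition_pos hint hsm hs (u 0) hε.le
  have hprod : ∀ ε, shiftedDensity s p g t ε n ((w, ω), u)
      = (∏ l, gibbsWeight s p g t w (u l) ω)
          * Real.exp (ε * (t * ∑ l, overlap s w (u l) (u 0) ^ p))
          / shiftedPartition s p g t ε w (u 0) ω ^ (n + 1) := fun ε => by
    rw [shiftedDensity, Finset.prod_mul_distrib, ← Real.exp_sum, Finset.mul_sum, Finset.mul_sum]
  simp_rw [hprod]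
  have h1 := ((hasDerivAt_id ε).mul_const (t * ∑ l, overlap s w (u l) (u 0) ^ p)).exp.const_mul
    (∏ l, gibbsWeight s p g t w (u l) ω)
  have h2 := (hasDerivAt_shiftedPartition hint hsm hs (u 0) hε).pow (n + 1)
  refine (h1.div h2 (pow_ne_zero _ hpos.ne')).congr_deriv ?_
  simp only [id, Nat.add_sub_cancel, Pi.pow_apply]
  push_cast
  field_simp
  ring

end Pointwise

variable [MeasurableSpace Ω]

lemma measurable_gibbsWeight_comp (hsm : Measurable fun x : I × I × I => s x.1 x.2.1 x.2.2)
    (hg : Measurable fun x : I × I × Ω => g x.1 x.2.1 x.2.2)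
    {α : Type*} [MeasurableSpace α] {f₁ f₂ : α → I} {f₃ : α → Ω} (h₁ : Measurable f₁)
    (h₂ : Measurable f₂) (h₃ : Measurable f₃) :
    Measurable fun x => gibbsWeight s p g t (f₁ x) (f₂ x) (f₃ x) :=
  (measurable_gibbsWeight hsm hg).comp
    (g := fun x : I × I × Ω => gibbsWeight s p g t x.1 x.2.1 x.2.2)
    (f := fun x => (f₁ x, f₂ x, f₃ x)) (by fun_prop)

lemma measurable_shiftedWeight (hsm : Measurable fun x : I × I × I => s x.1 x.2.1 x.2.2)
    (hg : Measurable fun x : I × I × Ω => g x.1 x.2.1 x.2.2) {α : Type*} [MeasurableSpace α]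
    {f₁ f₂ f₃ : α → I} {f₄ : α → Ω} (h₁ : Measurable f₁) (h₂ : Measurable f₂)
    (h₃ : Measurable f₃) (h₄ : Measurable f₄) (ε : ℝ) :
    Measurable fun x => gibbsWeight s p g t (f₁ x) (f₂ x) (f₄ x)
      * Real.exp (ε * (t * overlap s (f₁ x) (f₂ x) (f₃ x) ^ p)) :=
  (measurable_gibbsWeight_comp hsm hg h₁ h₂ h₄).mul
    ((((measurable_overlap_comp hsm h₁ h₂ h₃).pow_const p).const_mul t).const_mul ε).exp

lemma measurable_shiftedPartition (hsm : Measurable fun x : I × I × I => s x.1 x.2.1 x.2.2)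
    (hg : Measurable fun x : I × I × Ω => g x.1 x.2.1 x.2.2) {α : Type*} [MeasurableSpace α]
    {f₁ f₂ : α → I} {f₃ : α → Ω} (h₁ : Measurable f₁) (h₂ : Measurable f₂) (h₃ : Measurable f₃)
    (ε : ℝ) : Measurable fun x => shiftedPartition s p g t ε (f₁ x) (f₂ x) (f₃ x) := by
  have : Measurable fun y : α × I => gibbsWeight s p g t (f₁ y.1) y.2 (f₃ y.1)
      * Real.exp (ε * (t * overlap s (f₁ y.1) y.2 (f₂ y.1) ^ p)) :=
    measurable_shiftedWeight hsm hg (by fun_prop) (by fun_prop) (by fun_prop) (by fun_prop) ε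
  exact this.stronglyMeasurable.integral_prod_right'.measurable

lemma measurable_shiftedMean (hsm : Measurable fun x : I × I × I => s x.1 x.2.1 x.2.2)
    (hg : Measurable fun x : I × I × Ω => g x.1 x.2.1 x.2.2) {α : Type*} [MeasurableSpace α]
    {f₁ f₂ : α → I} {f₃ : α → Ω} (h₁ : Measurable f₁) (h₂ : Measurable f₂) (h₃ : Measurable f₃)
    (ε : ℝ) : Measurable fun x => shiftedMean s p g t ε (f₁ x) (f₂ x) (f₃ x) := by
  have : Measurable fun y : α × I => overlap s (f₁ y.1) y.2 (f₂ y.1) ^ p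
      * (gibbsWeight s p g t (f₁ y.1) y.2 (f₃ y.1)
        * Real.exp (ε * (t * overlap s (f₁ y.1) y.2 (f₂ y.1) ^ p))) :=
    ((measurable_overlap_comp hsm (by fun_prop) (by fun_prop) (by fun_prop)).pow_const p).mul
      (measurable_shiftedWeight hsm hg (by fun_prop) (by fun_prop) (by fun_prop) (by fun_prop) ε)
  exact this.stronglyMeasurable.integral_prod_right'.measurable.div
    (measurable_shiftedPartition hsm hg h₁ h₂ h₃ ε)

lemma measurable_shiftedDensity (hsm : Measurable fun x : I × I × I => s x.1 x.2.1 x.2.2)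
    (hg : Measurable fun x : I × I × Ω => g x.1 x.2.1 x.2.2) (ε : ℝ) (n : ℕ) :
    Measurable (shiftedDensity s p g t ε n) := by
  refine Measurable.div (Finset.measurable_fun_prod _ fun l _ => ?_)
    ((measurable_shiftedPartition hsm hg ?_ ?_ ?_ ε).pow_const _)
  · exact measurable_shiftedWeight hsm hg (by fun_prop) (by fun_prop) (by fun_prop) (by fun_prop) ε
  all_goals fun_prop

end ShiftedGibbs

/-! ### Gaussian integration by parts as a derivative at `ε = 0`. -/

section IntegrationByParts

variable {Ω : Type*} [MeasurableSpace Ω] {P : Measure Ω} [IsProbabilityMeasure P]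
  {s : I → I → I → ℝ} {p : ℕ} {g : I → I → Ω → ℝ} {t : ℝ}

namespace IsOverlapGaussianProcess

/-- The Cameron-Martin formula in a fixed environment, with fixed replicas. -/
lemma integral_shift_of_integrable (hg : IsOverlapGaussianProcess P s p g)
    (hsm : Measurable fun x : I × I × I => s x.1 x.2.1 x.2.2)
    (hs : ∀ w u v, s w u v ∈ Set.Icc (-1 : ℝ) 1) {w : I}
    (hint : ∀ᵐ ω ∂P, Integrable fun u : I => gibbsWeight s p g t w u ω) {ε : ℝ} (hε : |ε| ≤ 1)
    {n : ℕ} (u : Fin (n + 1) → I) (a b : ℝ) :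
    ∫ ω, (a + b * g w (u 0) ω) * gibbsDensity s p g t (n + 1) ((w, ω), u)
        * Real.exp (ε * g w (u 0) ω - ε ^ 2 * overlap s w (u 0) (u 0) ^ p / 2) ∂P
      = ∫ ω, (a + b * (g w (u 0) ω + ε * overlap s w (u 0) (u 0) ^ p))
        * shiftedDensity s p g t ε n ((w, ω), u) ∂P := by
  have hshift : ∀ u' ω, Real.exp (t * (g w u' ω + ε * cov[g w u', g w (u 0); P])
        + t ^ 2 * (1 - overlap s w u' u' ^ p) / 2)
      = gibbsWeight s p g t w u' ω * Real.exp (ε * (t * overlap s w u' (u 0) ^ p)) :=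
    fun u' ω => by
      rw [gibbsWeight, ← Real.exp_add, hg.covariance_eq]
      congr 1
      ring
  have h := integral_gaussianTilt_partition (P := P) (μ := (volume : Measure I)) (X := g w)
    (hg.isGaussianProcess w)
    (hg.measurable_apply measurable_const measurable_fst measurable_snd) (hg.mean_eq_zero w)
    (a := u 0) (ε := ε) (t := t) (c := fun u => t ^ 2 * (1 - overlap s w u u ^ p) / 2)
    (((((measurable_overlap_comp hsm measurable_const measurable_id
      measurable_id).pow_const p).const_sub 1).const_mul (t ^ 2)).div_const 2)
    (by
      simp_rw [hg.covariance_eq]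
      exact (measurable_overlap_comp hsm measurable_const measurable_id
        measurable_const).pow_const p)
    hint
    (by
      filter_upwards [hint] with ω hω
      simp_rw [hshift]
      exact integrable_shiftedWeight hω hsm hs (u 0) hε) u
    -- With `w` and the replicas frozen, the coefficients and self-overlaps are constants. Test
    -- function and density then depend only on the field at the `n + 1` replicas and on the
    -- partition function.
    (Φ := fun x => (a + b * x.1 0) *
      ((∏ l, Real.exp (t * x.1 l + t ^ 2 * (1 - overlap s w (u l) (u l) ^ p) / 2))
        / x.2 ^ (n + 1))) (by fun_prop)
  simp_rw [hshift] at h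
  simp only [hg.variance_eq, hg.covariance_eq] at h
  exact h

variable {n : ℕ} {a b : I × (Fin (n + 1) → I) → ℝ} {A B : ℝ}

/-- The test functions for the Gaussian integration by parts: affine functions of the value of the
process at the first replica. -/
def affineTest (g : I → I → Ω → ℝ) (a b : I × (Fin (n + 1) → I) → ℝ)
    (x : (I × Ω) × (Fin (n + 1) → I)) : ℝ :=
  a (x.1.1, x.2) + b (x.1.1, x.2) * g x.1.1 (x.2 0) x.1.2

lemma hasAllMoments_of_bound {f : I × (Fin n → I) → ℝ} (hf : Measurable f)
    (hA : ∀ y, |f y| ≤ A) :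
    HasAllMoments (fun x : (I × Ω) × (Fin n → I) => f (x.1.1, x.2)) (replicaMeasure P n) :=
  .of_bound (hf.comp (by fun_prop)).aestronglyMeasurable A fun _ => hA _

lemma hasAllMoments_affineTest (hg : IsOverlapGaussianProcess P s p g)
    (hs : ∀ w u v, s w u v ∈ Set.Icc (-1 : ℝ) 1) (ha : Measurable a) (hA : ∀ y, |a y| ≤ A)
    (hb : Measurable b) (hB : ∀ y, |b y| ≤ B) :
    HasAllMoments (affineTest g a b) (replicaMeasure P (n + 1)) :=
  (hasAllMoments_of_bound ha hA).add
    ((hasAllMoments_of_bound hb hB).mul (hg.hasAllMoments_replica hs 0))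

lemma ae_replicaMeasure {Ω : Type*} [MeasurableSpace Ω] {P : Measure Ω} {q : I × Ω → Prop}
    (h : ∀ᵐ y ∂((volume : Measure I).prod P), q y) (n : ℕ) : ∀ᵐ x ∂(replicaMeasure P n), q x.1 :=
  (Measure.quasiMeasurePreserving_fst (ν := (volume : Measure (Fin n → I)))).ae h

lemma hasAllMoments_shiftedDensity (hg : IsOverlapGaussianProcess P s p g)
    (hsm : Measurable fun x : I × I × I => s x.1 x.2.1 x.2.2)
    (hs : ∀ w u v, s w u v ∈ Set.Icc (-1 : ℝ) 1) {ε : ℝ} (hε : |ε| ≤ 1) (n : ℕ) :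
    HasAllMoments (shiftedDensity s p g t ε n) (replicaMeasure P (n + 1)) := by
  refine ((HasAllMoments.const (Real.exp (2 * |t|) ^ (n + 1))).mul
    (hg.hasAllMoments_gibbsDensity (t := t) hsm hs (n + 1))).mono
    (measurable_shiftedDensity hsm hg.measurable ε n).aestronglyMeasurable ?_
  filter_upwards [ae_replicaMeasure (hg.integrable_gibbsWeight (t := t) hsm hs) (n + 1)] with x hx
  rw [abs_of_nonneg (shiftedDensity_nonneg x)]
  exact shiftedDensity_le hx hsm hs hε x.2

lemma hasAllMoments_overlap_pow (hsm : Measurable fun x : I × I × I => s x.1 x.2.1 x.2.2)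
    (hs : ∀ w u v, s w u v ∈ Set.Icc (-1 : ℝ) 1) (i j : Fin n) :
    HasAllMoments (fun x : (I × Ω) × (Fin n → I) => overlap s x.1.1 (x.2 i) (x.2 j) ^ p)
      (replicaMeasure P n) :=
  .of_bound ((measurable_overlap_comp hsm (by fun_prop) (by fun_prop)
    (by fun_prop)).pow_const p).aestronglyMeasurable 1 fun _ => abs_overlap_pow_le_one hs p _ _ _

lemma hasAllMoments_exp_shift (hg : IsOverlapGaussianProcess P s p g)
    (hsm : Measurable fun x : I × I × I => s x.1 x.2.1 x.2.2)
    (hs : ∀ w u v, s w u v ∈ Set.Icc (-1 : ℝ) 1) (ε : ℝ) :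
    HasAllMoments (fun x : (I × Ω) × (Fin (n + 1) → I) => Real.exp (ε * g x.1.1 (x.2 0) x.1.2
      - ε ^ 2 * overlap s x.1.1 (x.2 0) (x.2 0) ^ p / 2)) (replicaMeasure P (n + 1)) := by
  refine (hg.hasAllMoments_exp_replica hs ε 0).mono ?_ (.of_forall fun x => ?_)
  · exact (((hg.measurable_replica 0).const_mul ε).sub
      ((((measurable_overlap_comp hsm (by fun_prop) (by fun_prop)
        (by fun_prop)).pow_const p).const_mul _).div_const 2)).exp.aestronglyMeasurable
  · rw [Real.abs_exp]
    gcongr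
    have := mul_nonneg (sq_nonneg ε)
      (pow_nonneg (overlap_self_nonneg (s := s) x.1.1 (x.2 0)) p)
    linarith

lemma integral_shift (hg : IsOverlapGaussianProcess P s p g)
    (hsm : Measurable fun x : I × I × I => s x.1 x.2.1 x.2.2)
    (hs : ∀ w u v, s w u v ∈ Set.Icc (-1 : ℝ) 1) (ha : Measurable a) (hA : ∀ y, |a y| ≤ A)
    (hb : Measurable b) (hB : ∀ y, |b y| ≤ B) {ε : ℝ} (hε : |ε| ≤ 1) :
    ∫ x, affineTest g a b x * gibbsDensity s p g t (n + 1) x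
        * Real.exp (ε * g x.1.1 (x.2 0) x.1.2 - ε ^ 2 * overlap s x.1.1 (x.2 0) (x.2 0) ^ p / 2)
        ∂(replicaMeasure P (n + 1))
      = ∫ x, (affineTest g a b x
          + ε * (b (x.1.1, x.2) * overlap s x.1.1 (x.2 0) (x.2 0) ^ p))
        * shiftedDensity s p g t ε n x ∂(replicaMeasure P (n + 1)) := by
  have hH := hg.hasAllMoments_affineTest hs ha hA hb hB
  have i1 := ((hH.mul (hg.hasAllMoments_gibbsDensity (t := t) hsm hs (n + 1))).mul
    (hg.hasAllMoments_exp_shift hsm hs ε)).integrable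
  have i2 := ((hH.add ((HasAllMoments.const ε).mul ((hasAllMoments_of_bound hb hB).mul
    (hasAllMoments_overlap_pow (p := p) hsm hs 0 0)))).mul
    (hg.hasAllMoments_shiftedDensity (t := t) hsm hs hε n)).integrable
  unfold replicaMeasure at i1 i2 ⊢
  -- The replicas are integrated last, so that the inner integral over `ω` has `w` and `u` fixed, as
  -- the Cameron-Martin formula requires.
  rw [integral_prod_symm _ i1, integral_prod_symm _ i2]
  refine integral_congr_ae ?_
  filter_upwards [i1.prod_left_ae, i2.prod_left_ae] with u hu1 hu2
  rw [integral_prod _ hu1, integral_prod _ hu2]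
  refine integral_congr_ae ?_
  filter_upwards [Measure.ae_ae_of_ae_prod (hg.integrable_gibbsWeight (t := t) hsm hs)] with w hw
  have := hg.integral_shift_of_integrable hsm hs hw hε u (a (w, u)) (b (w, u))
  convert this using 4 with ω
  · rfl
  · simp only [affineTest]
    ring

/-- Gaussian integration by parts, before the average over the additional replica is expanded. -/
lemma integral_affineTest_mul_replica (hg : IsOverlapGaussianProcess P s p g)
    (hsm : Measurable fun x : I × I × I => s x.1 x.2.1 x.2.2)
    (hs : ∀ w u v, s w u v ∈ Set.Icc (-1 : ℝ) 1) (ha : Measurable a) (hA : ∀ y, |a y| ≤ A)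
    (hb : Measurable b) (hB : ∀ y, |b y| ≤ B) :
    ∫ x, affineTest g a b x * gibbsDensity s p g t (n + 1) x * g x.1.1 (x.2 0) x.1.2
        ∂(replicaMeasure P (n + 1))
      = ∫ x, (b (x.1.1, x.2) * overlap s x.1.1 (x.2 0) (x.2 0) ^ p
            * gibbsDensity s p g t (n + 1) x
          + affineTest g a b x * (gibbsDensity s p g t (n + 1) x *
            (t * (∑ l, overlap s x.1.1 (x.2 l) (x.2 0) ^ p
              - (n + 1) * shiftedMean s p g t 0 x.1.1 (x.2 0) x.1.2))))
          ∂(replicaMeasure P (n + 1)) := by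
  have hH := hg.hasAllMoments_affineTest hs ha hA hb hB
  have hρ := hg.hasAllMoments_gibbsDensity (t := t) hsm hs (n + 1)
  have hbD := (hasAllMoments_of_bound (P := P) hb hB).mul
    (hasAllMoments_overlap_pow (p := p) (P := P) hsm hs (0 : Fin (n + 1)) 0)
  have hball : Metric.ball (0 : ℝ) 1 ∈ nhds (0 : ℝ) := Metric.ball_mem_nhds _ one_pos
  have hmem : ∀ {ε : ℝ}, ε ∈ Metric.ball (0 : ℝ) 1 → |ε| < 1 := fun h => by simpa using h
  have hD1 : ∀ x : (I × Ω) × (Fin (n + 1) → I), |overlap s x.1.1 (x.2 0) (x.2 0) ^ p| ≤ 1 :=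
    fun x => abs_overlap_pow_le_one hs p _ _ _
  have hae := ae_replicaMeasure (hg.integrable_gibbsWeight (t := t) hsm hs) (n + 1)
  have hRHS : ∀ {ε : ℝ}, |ε| ≤ 1 → HasAllMoments (fun x => (affineTest g a b x
      + ε * (b (x.1.1, x.2) * overlap s x.1.1 (x.2 0) (x.2 0) ^ p))
        * shiftedDensity s p g t ε n x) (replicaMeasure P (n + 1)) := fun hε =>
    (hH.add ((HasAllMoments.const _).mul hbD)).mul
      (hg.hasAllMoments_shiftedDensity (t := t) hsm hs hε n)
  -- Differentiating the exponential tilt at 0 brings down the factor `g`; differentiating the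
  -- shifted side, in `d2`, brings down covariances.
  have d1 : HasDerivAt (fun ε => ∫ x, affineTest g a b x * gibbsDensity s p g t (n + 1) x
        * Real.exp (ε * g x.1.1 (x.2 0) x.1.2 - ε ^ 2 * overlap s x.1.1 (x.2 0) (x.2 0) ^ p / 2)
        ∂(replicaMeasure P (n + 1)))
      (∫ x, affineTest g a b x * gibbsDensity s p g t (n + 1) x * g x.1.1 (x.2 0) x.1.2
        ∂(replicaMeasure P (n + 1))) 0 := by
    have h := (hasDerivAt_integral_of_dominated_loc_of_deriv_le
      (μ := replicaMeasure P (n + 1))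
      (F := fun ε x => affineTest g a b x * gibbsDensity s p g t (n + 1) x
        * Real.exp (ε * g x.1.1 (x.2 0) x.1.2
          - ε ^ 2 * overlap s x.1.1 (x.2 0) (x.2 0) ^ p / 2))
      (F' := fun ε x => affineTest g a b x * gibbsDensity s p g t (n + 1) x
        * (Real.exp (ε * g x.1.1 (x.2 0) x.1.2
          - ε ^ 2 * overlap s x.1.1 (x.2 0) (x.2 0) ^ p / 2)
          * (g x.1.1 (x.2 0) x.1.2 - ε * overlap s x.1.1 (x.2 0) (x.2 0) ^ p)))
      (bound := fun x => |affineTest g a b x| * gibbsDensity s p g t (n + 1) x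
        * (Real.exp |g x.1.1 (x.2 0) x.1.2| * (|g x.1.1 (x.2 0) x.1.2| + 1))) hball
      (.of_forall fun ε =>
        ((hH.mul hρ).mul (hg.hasAllMoments_exp_shift hsm hs ε)).aestronglyMeasurable)
      ((hH.mul hρ).mul (hg.hasAllMoments_exp_shift hsm hs 0)).integrable
      ((hH.mul hρ).mul ((hg.hasAllMoments_exp_shift hsm hs 0).mul
        ((hg.hasAllMoments_replica hs 0).sub ((HasAllMoments.const 0).mul
          (hasAllMoments_overlap_pow (p := p) hsm hs 0 0))))).aestronglyMeasurable
      (.of_forall fun x ε hε => ?_)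
      ((hH.abs.mul hρ).mul ((hg.hasAllMoments_exp_abs hs 0).mul
        ((hg.hasAllMoments_replica hs 0).abs.add (.const 1)))).integrable
      (.of_forall fun x ε hε => ?_)).2
    · simpa using h
    · have hε' := (hmem hε).le
      rw [norm_mul, norm_mul, norm_mul, Real.norm_eq_abs, Real.norm_eq_abs, Real.norm_eq_abs,
        Real.norm_eq_abs, abs_of_nonneg (gibbsDensity_nonneg x), Real.abs_exp]
      refine mul_le_mul_of_nonneg_left (mul_le_mul ?_ ?_ (abs_nonneg _) (Real.exp_pos _).le)
        (mul_nonneg (abs_nonneg _) (gibbsDensity_nonneg x))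
      · refine Real.exp_le_exp.2 ?_
        have h1 : ε * g x.1.1 (x.2 0) x.1.2 ≤ |g x.1.1 (x.2 0) x.1.2| := by
          refine (le_abs_self _).trans ?_
          rw [abs_mul]
          exact mul_le_of_le_one_left (abs_nonneg _) hε'
        have h2 := mul_nonneg (sq_nonneg ε)
          (pow_nonneg (overlap_self_nonneg (s := s) x.1.1 (x.2 0)) p)
        linarith
      · refine (abs_sub _ _).trans (add_le_add_right ?_ _)
        rw [abs_mul]
        exact mul_le_one₀ hε' (abs_nonneg _) (hD1 x)
    · have h1 := (((hasDerivAt_id ε).mul_const (g x.1.1 (x.2 0) x.1.2)).sub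
        ((((hasDerivAt_id ε).pow 2).mul_const (overlap s x.1.1 (x.2 0) (x.2 0) ^ p)).div_const
          2)).exp.const_mul (affineTest g a b x * gibbsDensity s p g t (n + 1) x)
      refine h1.congr_deriv ?_
      simp only [Pi.sub_apply, Pi.pow_apply, id]
      norm_num
      exact Or.inl (by ring)
  have d2 : HasDerivAt (fun ε => ∫ x, (affineTest g a b x
          + ε * (b (x.1.1, x.2) * overlap s x.1.1 (x.2 0) (x.2 0) ^ p))
        * shiftedDensity s p g t ε n x ∂(replicaMeasure P (n + 1)))
      (∫ x, (b (x.1.1, x.2) * overlap s x.1.1 (x.2 0) (x.2 0) ^ p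
            * gibbsDensity s p g t (n + 1) x
          + affineTest g a b x * (gibbsDensity s p g t (n + 1) x *
            (t * (∑ l, overlap s x.1.1 (x.2 l) (x.2 0) ^ p
              - (n + 1) * shiftedMean s p g t 0 x.1.1 (x.2 0) x.1.2))))
          ∂(replicaMeasure P (n + 1))) 0 := by
    have h := (hasDerivAt_integral_of_dominated_loc_of_deriv_le
      (μ := replicaMeasure P (n + 1))
      (F := fun ε x => (affineTest g a b x
          + ε * (b (x.1.1, x.2) * overlap s x.1.1 (x.2 0) (x.2 0) ^ p))
        * shiftedDensity s p g t ε n x)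
      (F' := fun ε x => b (x.1.1, x.2) * overlap s x.1.1 (x.2 0) (x.2 0) ^ p
          * shiftedDensity s p g t ε n x
        + (affineTest g a b x + ε * (b (x.1.1, x.2) * overlap s x.1.1 (x.2 0) (x.2 0) ^ p))
          * (shiftedDensity s p g t ε n x *
            (t * (∑ l, overlap s x.1.1 (x.2 l) (x.2 0) ^ p
              - (n + 1) * shiftedMean s p g t ε x.1.1 (x.2 0) x.1.2))))
      -- The first `B` bounds the derivative of the test function and the second its shift. The
      -- factor `2 (n + 1)` counts the `n + 1` covariances and the `n + 1` copies of their Gibbs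
      -- mean.
      (bound := fun x => (B + (|affineTest g a b x| + B) * (|t| * (2 * (n + 1))))
        * (Real.exp (2 * |t|) ^ (n + 1) * gibbsDensity s p g t (n + 1) x)) hball
      ?_ (hRHS (ε := 0) (by simp)).integrable ?_ ?_
      (((HasAllMoments.const B).add ((hH.abs.add (.const B)).mul (.const _))).mul
        ((HasAllMoments.const _).mul hρ)).integrable ?_).2
    · simpa [shiftedDensity_zero] using h
    · filter_upwards [hball] with ε hε
      exact (hRHS (hmem hε).le).aestronglyMeasurable
    · refine ((hbD.mul (hg.hasAllMoments_shiftedDensity (t := t) hsm hs (ε := 0) (by simp)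
        n)).aestronglyMeasurable).add ?_
      refine (hH.add ((HasAllMoments.const 0).mul hbD)).aestronglyMeasurable.mul ?_
      refine (hg.hasAllMoments_shiftedDensity (t := t) hsm hs (ε := 0)
        (by simp) n).aestronglyMeasurable.mul ?_
      refine AEStronglyMeasurable.const_mul ?_ t
      refine ((HasAllMoments.sum Finset.univ fun l _ => hasAllMoments_overlap_pow
        (p := p) hsm hs l 0).aestronglyMeasurable).sub ?_
      exact ((measurable_shiftedMean hsm hg.measurable (by fun_prop) (by fun_prop) (by fun_prop)
        0).const_mul _).aestronglyMeasurable
    · filter_upwards [hae] with x hx ε hε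
      have hε' := (hmem hε).le
      have h1 := shiftedDensity_le (n := n) hx hsm hs hε' x.2
      have h0 := shiftedDensity_nonneg (s := s) (p := p) (g := g) (t := t) (ε := ε) x
      have h2 : |b (x.1.1, x.2) * overlap s x.1.1 (x.2 0) (x.2 0) ^ p| ≤ B := by
        rw [abs_mul]
        exact (mul_le_of_le_one_right (abs_nonneg _) (hD1 x)).trans (hB _)
      have h3 : |affineTest g a b x
          + ε * (b (x.1.1, x.2) * overlap s x.1.1 (x.2 0) (x.2 0) ^ p)|
          ≤ |affineTest g a b x| + B := by
        refine (abs_add_le _ _).trans (add_le_add_right ?_ _)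
        rw [abs_mul]
        exact (mul_le_of_le_one_left (abs_nonneg _) hε').trans h2
      have h4 : |t * (∑ l, overlap s x.1.1 (x.2 l) (x.2 0) ^ p
          - (n + 1) * shiftedMean s p g t ε x.1.1 (x.2 0) x.1.2)| ≤ |t| * (2 * (n + 1)) := by
        rw [abs_mul]
        refine mul_le_mul_of_nonneg_left ((abs_sub _ _).trans ?_) (abs_nonneg t)
        have h5 : |∑ l, overlap s x.1.1 (x.2 l) (x.2 0) ^ p| ≤ n + 1 := by
          refine (Finset.abs_sum_le_sum_abs _ _).trans ?_
          refine (Finset.sum_le_sum fun l _ =>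
            abs_overlap_pow_le_one hs p x.1.1 (x.2 l) (x.2 0)).trans ?_
          simp
        have h6 : |(n + 1 : ℝ) * shiftedMean s p g t ε x.1.1 (x.2 0) x.1.2| ≤ n + 1 := by
          rw [abs_mul, abs_of_nonneg (by positivity : (0 : ℝ) ≤ n + 1)]
          exact mul_le_of_le_one_right (by positivity)
            (abs_shiftedMean_le_one hx hsm hs (x.2 0) hε')
        linarith
      rw [Real.norm_eq_abs]
      refine (abs_add_le _ _).trans ?_
      rw [abs_mul, abs_mul _ (shiftedDensity s p g t ε n x * _), abs_mul (shiftedDensity _ _ _ _ _ _ _),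
        abs_of_nonneg h0]
      have hB0 : 0 ≤ B := (abs_nonneg _).trans h2
      calc _ ≤ B * shiftedDensity s p g t ε n x + (|affineTest g a b x| + B)
              * (shiftedDensity s p g t ε n x * (|t| * (2 * (n + 1)))) := by gcongr
        _ = (B + (|affineTest g a b x| + B) * (|t| * (2 * (n + 1))))
              * shiftedDensity s p g t ε n x := by ring
        _ ≤ _ := mul_le_mul_of_nonneg_left h1 (by positivity)
    · filter_upwards [hae] with x hx ε hε
      refine HasDerivAt.mul ?_ (hasDerivAt_shiftedDensity hx hsm hs (hmem hε) x.2)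
      simpa using ((hasDerivAt_id ε).mul_const
        (b (x.1.1, x.2) * overlap s x.1.1 (x.2 0) (x.2 0) ^ p)).const_add (affineTest g a b x)
  refine d1.unique (d2.congr_of_eventuallyEq ?_)
  filter_upwards [hball] with ε hε
  exact hg.integral_shift hsm hs ha hA hb hB (hmem hε).le

end IsOverlapGaussianProcess

end IntegrationByParts

/-! ### The one-dimensional Gaussian variable `z`. -/

section StandardGaussian

/-- The Cameron-Martin formula for the standard Gaussian distribution. -/
lemma integral_mul_exp_gaussianReal {f : ℝ → ℝ} (hf : Measurable f) (r : ℝ) :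
    ∫ z, f z * Real.exp (r * z) ∂gaussianReal 0 1
      = Real.exp (r ^ 2 / 2) * ∫ z, f (z + r) ∂gaussianReal 0 1 := by
  -- The identity is viewed as a Gaussian process with a single index, so that the process formula
  -- applies.
  have hX : IsGaussianProcess (fun (_ : Unit) (z : ℝ) => z) (gaussianReal 0 1) :=
    ⟨fun J => (IsGaussian.hasGaussianLaw_id (μ := gaussianReal 0 1)).map_fun
      (ContinuousLinearMap.pi fun _ : J => ContinuousLinearMap.id ℝ ℝ)⟩
  have h := map_gaussianTilt_eq_map_add hX (fun _ => measurable_id)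
    (fun _ => integral_id_gaussianReal) () r
  have hv : Var[fun z : ℝ => z; gaussianReal 0 1] = 1 := by simp
  rw [covariance_self (X := fun z : ℝ => z) measurable_id'.aemeasurable, hv] at h
  have h1 : ∫ z, f z ∂(gaussianTilt (gaussianReal 0 1) (fun z : ℝ => z) r)
      = ∫ z, f (z + r) ∂gaussianReal 0 1 := by
    have hm : Measurable fun y : Unit → ℝ => f (y ()) := by fun_prop
    have e1 := integral_map (μ := gaussianTilt (gaussianReal 0 1) (fun z : ℝ => z) r)
      (φ := fun z (_ : Unit) => z) (by fun_prop) hm.aestronglyMeasurable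
    have e2 := integral_map (μ := gaussianReal 0 1)
      (φ := fun z (_ : Unit) => z + r * 1) (by fun_prop) hm.aestronglyMeasurable
    rw [h, e2] at e1
    simpa using e1.symm
  rw [integral_gaussianTilt measurable_id', hv] at h1
  rw [← h1, ← integral_const_mul]
  refine integral_congr_ae (.of_forall fun z => ?_)
  dsimp only
  rw [Real.exp_sub, mul_one]
  field_simp

lemma integrable_id_gaussianReal : Integrable (fun z : ℝ => z) (gaussianReal 0 1) :=
  (memLp_id_gaussianReal' 1 (by simp)).integrable le_rfl

lemma integrable_sq_gaussianReal : Integrable (fun z : ℝ => z ^ 2) (gaussianReal 0 1) :=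
  (memLp_id_gaussianReal' 2 (by simp)).integrable_sq

lemma integral_affine_gaussianReal (a c : ℝ) : ∫ z, (a + z * c) ∂gaussianReal 0 1 = a := by
  rw [integral_add (integrable_const _) (integrable_id_gaussianReal.mul_const c),
    integral_mul_const, integral_id_gaussianReal]
  simp

lemma integral_affine_sq_gaussianReal (a c : ℝ) :
    ∫ z, (a + z * c) ^ 2 ∂gaussianReal 0 1 = a ^ 2 + c ^ 2 := by
  have hsq : ∫ z : ℝ, z ^ 2 ∂gaussianReal 0 1 = 1 := by
    have h := variance_eq_sub (μ := gaussianReal 0 1) (X := fun z : ℝ => z)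
      (memLp_id_gaussianReal' 2 (by simp))
    simpa using h.symm
  have : ∀ z : ℝ, (a + z * c) ^ 2 = (a ^ 2 + z * (2 * a * c)) + z ^ 2 * c ^ 2 := fun z => by ring
  simp_rw [this]
  have hi : Integrable (fun z : ℝ => a ^ 2 + z * (2 * a * c)) (gaussianReal 0 1) :=
    (integrable_const _).add (integrable_id_gaussianReal.mul_const _)
  rw [integral_add hi (integrable_sq_gaussianReal.mul_const _), integral_affine_gaussianReal, integral_mul_const, hsq,
    one_mul]

end StandardGaussian

/-! ### Integrating out `z` in the replica expectation. -/

section ReplicaExpectation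

variable {Ω : Type*} {s : I → I → I → ℝ} {p : ℕ} {g : I → I → Ω → ℝ} {t : ℝ}

/-- The average over `z` of a function of `G_p`, under the tilt by `exp (t G_p)`. -/
lemma integral_bigG_mul_exp (hs : ∀ w u v, s w u v ∈ Set.Icc (-1 : ℝ) 1) {f : ℝ → ℝ}
    (hf : Measurable f) (w u : I) (ω : Ω) :
    ∫ z, f (bigG s p g w u ω z) * Real.exp (t * bigG s p g w u ω z) ∂gaussianReal 0 1
      = gibbsWeight s p g t w u ω * ∫ z, f (g w u ω + t * (1 - overlap s w u u ^ p)
          + z * √(1 - overlap s w u u ^ p)) ∂gaussianReal 0 1 := by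
  set c := √(1 - overlap s w u u ^ p) with hc
  have hc2 : c * c = 1 - overlap s w u u ^ p :=
    Real.mul_self_sqrt (sub_nonneg.2 (overlap_self_pow_le_one hs p w u))
  -- The tilt by `exp (t c z)` moves `z` by `t c`, hence `G_p` by `t c² = t (1 - R_{u,u}^p)`. This
  -- is the drift in `tiltedField`.
  have h := integral_mul_exp_gaussianReal (f := fun z => f (g w u ω + z * c)) (by fun_prop) (t * c)
  have e1 : ∀ z, f (bigG s p g w u ω z) * Real.exp (t * bigG s p g w u ω z)
      = Real.exp (t * g w u ω) * (f (g w u ω + z * c) * Real.exp (t * c * z)) := fun z => by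
    rw [bigG, ← hc, mul_add, Real.exp_add]
    ring_nf
  have e2 : gibbsWeight s p g t w u ω = Real.exp (t * g w u ω) * Real.exp ((t * c) ^ 2 / 2) := by
    rw [gibbsWeight, Real.exp_add, ← hc2]
    ring_nf
  simp_rw [e1]
  rw [integral_const_mul, h, e2, mul_assoc, ← hc2]
  congr 3
  ext z
  ring_nf

lemma replicaE_mul_exp (hs : ∀ w u v, s w u v ∈ Set.Icc (-1 : ℝ) 1) (w : I) (ω : Ω) (f : I → ℝ) :
    replicaE (fun u z => f u * Real.exp (t * bigG s p g w u ω z))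
      = ∫ u, f u * gibbsWeight s p g t w u ω := by
  refine integral_congr_ae (.of_forall fun u => ?_)
  have h := integral_bigG_mul_exp (p := p) (g := g) (t := t) hs (f := fun _ => 1)
    measurable_const w u ω
  simp only [one_mul, integral_const, probReal_univ, one_smul, mul_one] at h
  dsimp only
  rw [integral_const_mul, h]

lemma replicaE_exp (hs : ∀ w u v, s w u v ∈ Set.Icc (-1 : ℝ) 1) (w : I) (ω : Ω) :
    replicaE (fun u z => Real.exp (t * bigG s p g w u ω z)) = partitionFn s p g t w ω := by
  simpa [partitionFn] using replicaE_mul_exp (p := p) (g := g) (t := t) hs w ω fun _ => 1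

/-- The value of `G_p` at a replica, averaged over `z` under the tilt. -/
def tiltedField (s : I → I → I → ℝ) (p : ℕ) (g : I → I → Ω → ℝ) (t : ℝ) (w u : I) (ω : Ω) : ℝ :=
  g w u ω + t * (1 - overlap s w u u ^ p)

lemma replicaE_bigG_mul_exp (hs : ∀ w u v, s w u v ∈ Set.Icc (-1 : ℝ) 1) (w : I) (ω : Ω) :
    replicaE (fun u z => bigG s p g w u ω z ^ 1 * Real.exp (t * bigG s p g w u ω z))
      = ∫ u, tiltedField s p g t w u ω * gibbsWeight s p g t w u ω := by
  refine integral_congr_ae (.of_forall fun u => ?_)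
  have h := integral_bigG_mul_exp (p := p) (g := g) (t := t) hs (f := fun x => x ^ 1)
    (by fun_prop) w u ω
  dsimp only at h ⊢
  rw [h, mul_comm]
  simp only [pow_one, integral_affine_gaussianReal, tiltedField]

lemma replicaE_bigG_sq_mul_exp (hs : ∀ w u v, s w u v ∈ Set.Icc (-1 : ℝ) 1) (w : I) (ω : Ω) :
    replicaE (fun u z => bigG s p g w u ω z ^ 2 * Real.exp (t * bigG s p g w u ω z))
      = ∫ u, (tiltedField s p g t w u ω ^ 2 + (1 - overlap s w u u ^ p))
          * gibbsWeight s p g t w u ω := by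
  refine integral_congr_ae (.of_forall fun u => ?_)
  have h := integral_bigG_mul_exp (p := p) (g := g) (t := t) hs (f := fun x => x ^ 2)
    (by fun_prop) w u ω
  dsimp only at h ⊢
  rw [h, mul_comm, integral_affine_sq_gaussianReal,
    Real.sq_sqrt (sub_nonneg.2 (overlap_self_pow_le_one hs p w u)), tiltedField]

end ReplicaExpectation

/-! ### Factorization of the Gibbs density over replicas. -/

section GibbsAverages

variable {Ω : Type*} {s : I → I → I → ℝ} {p : ℕ} {g : I → I → Ω → ℝ} {t : ℝ}

lemma integral_prod_mul_gibbsDensity {n : ℕ} (f : Fin n → I → ℝ) (y : I × Ω) :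
    ∫ u : Fin n → I, (∏ l, f l (u l)) * gibbsDensity s p g t n (y, u)
      = (∏ l, ∫ u, f l u * gibbsWeight s p g t y.1 u y.2) / partitionFn s p g t y.1 y.2 ^ n := by
  simp only [gibbsDensity]
  simp_rw [← mul_div_assoc, ← Finset.prod_mul_distrib]
  rw [integral_div, ← integral_fintype_prod_volume_eq_prod]

/-- Each of the other `n` replicas integrates to one partition function and cancels one power in the
denominator. -/
lemma integral_first_mul_gibbsDensity {n : ℕ} (f : I → ℝ) {y : I × Ω}
    (hy : 0 < partitionFn s p g t y.1 y.2) :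
    ∫ u : Fin (n + 1) → I, f (u 0) * gibbsDensity s p g t (n + 1) (y, u)
      = (∫ u, f u * gibbsWeight s p g t y.1 u y.2) / partitionFn s p g t y.1 y.2 := by
  have h := integral_prod_mul_gibbsDensity (s := s) (p := p) (g := g) (t := t)
    (Fin.cons f fun (_ : Fin n) _ => 1) y
  simp only [Fin.prod_univ_succ, Fin.cons_zero, Fin.cons_succ, Finset.prod_const_one, one_mul,
    mul_one, Finset.prod_const, Finset.card_univ, Fintype.card_fin] at h
  rw [h]
  change _ * partitionFn s p g t y.1 y.2 ^ n / _ = _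
  rw [pow_succ]
  field_simp

lemma integral_pi_succ {n : ℕ} {f : (Fin (n + 1) → I) → ℝ} (hf : Integrable f) :
    ∫ u, f u = ∫ u : Fin n → I, ∫ v : I, f (Fin.snoc (α := fun _ => I) u v) := by
  have hmp := (volume_preserving_piFinSuccAbove (fun _ : Fin (n + 1) => I) (Fin.last n)).symm
  have he : ∀ x, (MeasurableEquiv.piFinSuccAbove (fun _ : Fin (n + 1) => I) (Fin.last n)).symm x
      = Fin.snoc (α := fun _ => I) x.2 x.1 := fun x => Fin.insertNth_last' _ _
  have hint := hmp.integrable_comp_of_integrable hf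
  rw [← hmp.integral_comp (MeasurableEquiv.measurableEmbedding _)]
  simp only [Function.comp_def, he, Measure.volume_eq_prod] at hint ⊢
  rw [integral_prod_symm _ hint]

lemma gibbsDensity_snoc {n : ℕ} (y : I × Ω) (u : Fin n → I) (v : I) :
    gibbsDensity s p g t (n + 1) (y, Fin.snoc (α := fun _ => I) u v)
      = gibbsDensity s p g t n (y, u)
        * (gibbsWeight s p g t y.1 v y.2 / partitionFn s p g t y.1 y.2) := by
  simp only [gibbsDensity, Fin.prod_univ_castSucc, Fin.snoc_castSucc, Fin.snoc_last, pow_succ]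
  rw [mul_div_mul_comm]

end GibbsAverages

/-! ### Moments of `G_p` and integration by parts under the Gibbs measure. -/

section TiltedMoments

variable {Ω : Type*} [MeasurableSpace Ω] {P : Measure Ω} [IsProbabilityMeasure P]
  {s : I → I → I → ℝ} {p : ℕ} {g : I → I → Ω → ℝ} {t : ℝ}

namespace IsOverlapGaussianProcess

/-- This lets the field itself serve as test function, which the second moment needs. -/
lemma tiltedField_eq_affineTest {Ω : Type*} {g : I → I → Ω → ℝ} {n : ℕ}
    (x : (I × Ω) × (Fin (n + 1) → I)) :
    tiltedField s p g t x.1.1 (x.2 0) x.1.2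
      = affineTest g (fun y => t * (1 - overlap s y.1 (y.2 0) (y.2 0) ^ p)) (fun _ => 1) x := by
  simp only [tiltedField, affineTest]
  ring

lemma integral_first_replica (hg : IsOverlapGaussianProcess P s p g)
    (hsm : Measurable fun x : I × I × I => s x.1 x.2.1 x.2.2)
    (hs : ∀ w u v, s w u v ∈ Set.Icc (-1 : ℝ) 1) {n : ℕ} {f : I → I → Ω → ℝ}
    (hf : Integrable (fun x => f x.1.1 (x.2 0) x.1.2 * gibbsDensity s p g t (n + 1) x)
      (replicaMeasure P (n + 1))) :
    ∫ x, f x.1.1 (x.2 0) x.1.2 * gibbsDensity s p g t (n + 1) x ∂(replicaMeasure P (n + 1))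
      = ∫ w : I, ∫ ω, (∫ u, f w u ω * gibbsWeight s p g t w u ω) / partitionFn s p g t w ω ∂P := by
  unfold replicaMeasure at hf ⊢
  have hae : ∀ᵐ y ∂((volume : Measure I).prod P), ∫ u : Fin (n + 1) → I,
      f y.1 (u 0) y.2 * gibbsDensity s p g t (n + 1) (y, u)
      = (∫ u, f y.1 u y.2 * gibbsWeight s p g t y.1 u y.2) / partitionFn s p g t y.1 y.2 := by
    filter_upwards [hg.partitionFn_pos (t := t) hsm hs] with y hy
    exact integral_first_mul_gibbsDensity (fun u => f y.1 u y.2) hy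
  rw [integral_prod _ hf, integral_congr_ae hae, integral_prod]
  exact hf.integral_prod_left.congr hae

variable {n : ℕ} {a b : I × (Fin (n + 1) → I) → ℝ} {A B : ℝ}

lemma hasAllMoments_one_sub_overlap_self (hsm : Measurable fun x : I × I × I => s x.1 x.2.1 x.2.2)
    (hs : ∀ w u v, s w u v ∈ Set.Icc (-1 : ℝ) 1) :
    HasAllMoments (fun x : (I × Ω) × (Fin (n + 1) → I) =>
      1 - overlap s x.1.1 (x.2 0) (x.2 0) ^ p) (replicaMeasure P (n + 1)) :=
  (HasAllMoments.const 1).sub (hasAllMoments_overlap_pow hsm hs 0 0)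

lemma hasAllMoments_tiltedField (hg : IsOverlapGaussianProcess P s p g)
    (hsm : Measurable fun x : I × I × I => s x.1 x.2.1 x.2.2)
    (hs : ∀ w u v, s w u v ∈ Set.Icc (-1 : ℝ) 1) :
    HasAllMoments (fun x : (I × Ω) × (Fin (n + 1) → I) =>
      tiltedField s p g t x.1.1 (x.2 0) x.1.2) (replicaMeasure P (n + 1)) :=
  (hg.hasAllMoments_replica hs 0).add
    ((HasAllMoments.const t).mul (hasAllMoments_one_sub_overlap_self hsm hs))

lemma tiltedMoment_one_eq (hg : IsOverlapGaussianProcess P s p g)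
    (hsm : Measurable fun x : I × I × I => s x.1 x.2.1 x.2.2)
    (hs : ∀ w u v, s w u v ∈ Set.Icc (-1 : ℝ) 1) (n : ℕ) :
    tiltedMoment P s p g t 1
      = ∫ x, tiltedField s p g t x.1.1 (x.2 0) x.1.2 * gibbsDensity s p g t (n + 1) x
          ∂(replicaMeasure P (n + 1)) := by
  rw [hg.integral_first_replica hsm hs (f := tiltedField s p g t)
    ((hg.hasAllMoments_tiltedField hsm hs).mul
      (hg.hasAllMoments_gibbsDensity hsm hs (n + 1))).integrable, tiltedMoment]
  simp_rw [replicaE_exp hs, replicaE_bigG_mul_exp hs]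

/-- The extra `1 - R₀₀^p` is the conditional variance coming from `z`. The number of replicas is
free so that the formula can be compared with averages of any `F`. -/
lemma tiltedMoment_two_eq (hg : IsOverlapGaussianProcess P s p g)
    (hsm : Measurable fun x : I × I × I => s x.1 x.2.1 x.2.2)
    (hs : ∀ w u v, s w u v ∈ Set.Icc (-1 : ℝ) 1) (n : ℕ) :
    tiltedMoment P s p g t 2
      = ∫ x, (tiltedField s p g t x.1.1 (x.2 0) x.1.2 ^ 2
            + (1 - overlap s x.1.1 (x.2 0) (x.2 0) ^ p)) * gibbsDensity s p g t (n + 1) x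
          ∂(replicaMeasure P (n + 1)) := by
  rw [hg.integral_first_replica hsm hs
    (f := fun w u ω => tiltedField s p g t w u ω ^ 2 + (1 - overlap s w u u ^ p))
    ((((hg.hasAllMoments_tiltedField hsm hs).pow 2).add
      (hasAllMoments_one_sub_overlap_self hsm hs)).mul
      (hg.hasAllMoments_gibbsDensity hsm hs (n + 1))).integrable, tiltedMoment]
  simp_rw [replicaE_exp hs, replicaE_bigG_sq_mul_exp hs]

lemma integral_gibbsDensity (hg : IsOverlapGaussianProcess P s p g)
    (hsm : Measurable fun x : I × I × I => s x.1 x.2.1 x.2.2)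
    (hs : ∀ w u v, s w u v ∈ Set.Icc (-1 : ℝ) 1) (n : ℕ) :
    ∫ x, gibbsDensity s p g t (n + 1) x ∂(replicaMeasure P (n + 1)) = 1 := by
  have hρ := hg.hasAllMoments_gibbsDensity (t := t) hsm hs (n + 1)
  have h := hg.integral_first_replica (t := t) hsm hs (n := n) (f := fun _ _ _ => 1)
    (by simpa using hρ.integrable)
  simp only [one_mul] at h
  rw [h]
  have hae : ∀ᵐ w : I, ∫ ω, (∫ u, gibbsWeight s p g t w u ω) / partitionFn s p g t w ω ∂P = 1 := by
    filter_upwards [Measure.ae_ae_of_ae_prod (hg.partitionFn_pos (t := t) hsm hs)] with w hw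
    have : ∀ᵐ ω ∂P, (∫ u, gibbsWeight s p g t w u ω) / partitionFn s p g t w ω = 1 := by
      filter_upwards [hw] with ω hω
      exact div_self hω.ne'
    rw [integral_congr_ae this]
    simp
  rw [integral_congr_ae hae]
  simp

lemma hasAllMoments_shiftedMean (hg : IsOverlapGaussianProcess P s p g)
    (hsm : Measurable fun x : I × I × I => s x.1 x.2.1 x.2.2)
    (hs : ∀ w u v, s w u v ∈ Set.Icc (-1 : ℝ) 1) :
    HasAllMoments (fun x : (I × Ω) × (Fin (n + 1) → I) =>
      shiftedMean s p g t 0 x.1.1 (x.2 0) x.1.2) (replicaMeasure P (n + 1)) := by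
  refine (HasAllMoments.const 1).mono (measurable_shiftedMean hsm hg.measurable (by fun_prop)
    (by fun_prop) (by fun_prop) 0).aestronglyMeasurable ?_
  filter_upwards [ae_replicaMeasure (hg.integrable_gibbsWeight (t := t) hsm hs) (n + 1)] with x hx
  exact abs_shiftedMean_le_one hx hsm hs (x.2 0) (by simp)

/-- The Gibbs average of the covariance is the average over an additional replica. -/
lemma integral_mul_shiftedMean (hg : IsOverlapGaussianProcess P s p g)
    (hsm : Measurable fun x : I × I × I => s x.1 x.2.1 x.2.2)
    (hs : ∀ w u v, s w u v ∈ Set.Icc (-1 : ℝ) 1) (ha : Measurable a) (hA : ∀ y, |a y| ≤ A)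
    (hb : Measurable b) (hB : ∀ y, |b y| ≤ B) :
    ∫ x, affineTest g a b x * (gibbsDensity s p g t (n + 1) x
        * shiftedMean s p g t 0 x.1.1 (x.2 0) x.1.2) ∂(replicaMeasure P (n + 1))
      = ∫ x, affineTest g a b (x.1, fun l => x.2 l.castSucc)
          * overlap s x.1.1 (x.2 0) (x.2 (Fin.last (n + 1))) ^ p
          * gibbsDensity s p g t (n + 2) x ∂(replicaMeasure P (n + 2)) := by
  have hH' : HasAllMoments (fun x : (I × Ω) × (Fin (n + 2) → I) =>
      affineTest g a b (x.1, fun l => x.2 l.castSucc)) (replicaMeasure P (n + 2)) :=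
    hg.hasAllMoments_affineTest hs
      (a := fun y => a (y.1, fun l => y.2 l.castSucc))
      (b := fun y => b (y.1, fun l => y.2 l.castSucc))
      (ha.comp (by fun_prop)) (fun _ => hA _) (hb.comp (by fun_prop)) (fun _ => hB _)
  have i2 := ((hH'.mul (hasAllMoments_overlap_pow (p := p) hsm hs 0 (Fin.last (n + 1)))).mul
    (hg.hasAllMoments_gibbsDensity (t := t) hsm hs (n + 2))).integrable
  have hM := hg.hasAllMoments_shiftedMean (n := n) (t := t) hsm hs
  have i1 := ((hg.hasAllMoments_affineTest hs ha hA hb hB).mul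
    ((hg.hasAllMoments_gibbsDensity (t := t) hsm hs (n + 1)).mul hM)).integrable
  unfold replicaMeasure at i1 i2 ⊢
  rw [integral_prod _ i1, integral_prod _ i2]
  refine integral_congr_ae ?_
  filter_upwards [i2.prod_right_ae] with y hy
  -- The overlap with the new replica is the only factor coupled to it, so integrating it out leaves
  -- a Gibbs mean.
  rw [integral_pi_succ hy]
  refine integral_congr_ae (.of_forall fun u => ?_)
  have h0 : ∀ v : I, (Fin.snoc (α := fun _ => I) u v : Fin (n + 2) → I) 0 = u 0 := fun v =>
    Fin.snoc_castSucc (α := fun _ => I) v u 0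
  simp only [gibbsDensity_snoc, Fin.snoc_castSucc, Fin.snoc_last, h0]
  have : ∀ v : I, affineTest g a b (y, u) * overlap s y.1 (u 0) v ^ p
      * (gibbsDensity s p g t (n + 1) (y, u)
        * (gibbsWeight s p g t y.1 v y.2 / partitionFn s p g t y.1 y.2))
      = affineTest g a b (y, u) * gibbsDensity s p g t (n + 1) (y, u)
        * (overlap s y.1 v (u 0) ^ p * gibbsWeight s p g t y.1 v y.2
          / partitionFn s p g t y.1 y.2) := fun v => by
    rw [overlap_comm]
    ring
  simp_rw [this]
  rw [integral_const_mul, integral_div, mul_assoc]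
  simp [shiftedMean, shiftedPartition, partitionFn]

/-- Gaussian integration by parts for the Gibbs measure. -/
theorem integral_affineTest_mul_tiltedField (hg : IsOverlapGaussianProcess P s p g)
    (hsm : Measurable fun x : I × I × I => s x.1 x.2.1 x.2.2)
    (hs : ∀ w u v, s w u v ∈ Set.Icc (-1 : ℝ) 1) (ha : Measurable a) (hA : ∀ y, |a y| ≤ A)
    (hb : Measurable b) (hB : ∀ y, |b y| ≤ B) :
    ∫ x, affineTest g a b x * tiltedField s p g t x.1.1 (x.2 0) x.1.2
        * gibbsDensity s p g t (n + 1) x ∂(replicaMeasure P (n + 1))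
      = ∫ x, (b (x.1.1, x.2) * overlap s x.1.1 (x.2 0) (x.2 0) ^ p + t * affineTest g a b x)
            * gibbsDensity s p g t (n + 1) x ∂(replicaMeasure P (n + 1))
        + t * ∑ l : Fin n, ∫ x, affineTest g a b x * overlap s x.1.1 (x.2 0) (x.2 l.succ) ^ p
            * gibbsDensity s p g t (n + 1) x ∂(replicaMeasure P (n + 1))
        - t * (n + 1) * ∫ x, affineTest g a b (x.1, fun l => x.2 l.castSucc)
            * overlap s x.1.1 (x.2 0) (x.2 (Fin.last (n + 1))) ^ p
            * gibbsDensity s p g t (n + 2) x ∂(replicaMeasure P (n + 2)) := by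
  have hH := hg.hasAllMoments_affineTest hs ha hA hb hB
  have hρ := hg.hasAllMoments_gibbsDensity (t := t) hsm hs (n + 1)
  have hK : ∀ l : Fin (n + 1), HasAllMoments (fun x : (I × Ω) × (Fin (n + 1) → I) =>
      overlap s x.1.1 (x.2 0) (x.2 l) ^ p) (replicaMeasure P (n + 1)) :=
    fun l => hasAllMoments_overlap_pow hsm hs 0 l
  have hM := hg.hasAllMoments_shiftedMean (n := n) (t := t) hsm hs
  have hibp := hg.integral_affineTest_mul_replica (t := t) hsm hs ha hA hb hB
  have hmean := hg.integral_mul_shiftedMean (t := t) hsm hs ha hA hb hB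
  have j1 := ((hH.mul hρ).mul (hg.hasAllMoments_replica hs 0)).integrable
  have j2 := (((HasAllMoments.const t).mul hH).mul
    (hasAllMoments_one_sub_overlap_self (p := p) hsm hs)).mul hρ
  have j4 : ∀ l : Fin n, HasAllMoments (fun x => affineTest g a b x
      * overlap s x.1.1 (x.2 0) (x.2 l.succ) ^ p * gibbsDensity s p g t (n + 1) x)
      (replicaMeasure P (n + 1)) := fun l => (hH.mul (hK l.succ)).mul hρ
  have j5 := hH.mul (hρ.mul hM)
  -- The drift `t (1 - R₀₀^p)` of the field is split off. It will combine with the self term `t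
  -- R₀₀^p` of the sum over `l` to give exactly `t`.
  have e0 : ∀ x : (I × Ω) × (Fin (n + 1) → I),
      affineTest g a b x * tiltedField s p g t x.1.1 (x.2 0) x.1.2 * gibbsDensity s p g t (n + 1) x
      = affineTest g a b x * gibbsDensity s p g t (n + 1) x * g x.1.1 (x.2 0) x.1.2
        + t * affineTest g a b x * (1 - overlap s x.1.1 (x.2 0) (x.2 0) ^ p)
          * gibbsDensity s p g t (n + 1) x := fun x => by
    rw [tiltedField]
    ring
  simp_rw [e0]
  rw [integral_add j1 j2.integrable, hibp, ← hmean]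
  have e1 : ∀ x : (I × Ω) × (Fin (n + 1) → I),
      b (x.1.1, x.2) * overlap s x.1.1 (x.2 0) (x.2 0) ^ p * gibbsDensity s p g t (n + 1) x
        + affineTest g a b x * (gibbsDensity s p g t (n + 1) x *
            (t * (∑ l, overlap s x.1.1 (x.2 l) (x.2 0) ^ p
              - (n + 1) * shiftedMean s p g t 0 x.1.1 (x.2 0) x.1.2)))
      = (b (x.1.1, x.2) * overlap s x.1.1 (x.2 0) (x.2 0) ^ p + t * affineTest g a b x)
            * gibbsDensity s p g t (n + 1) x
        + t * (∑ l : Fin n, affineTest g a b x * overlap s x.1.1 (x.2 0) (x.2 l.succ) ^ p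
            * gibbsDensity s p g t (n + 1) x)
        - t * (n + 1) * (affineTest g a b x * (gibbsDensity s p g t (n + 1) x
            * shiftedMean s p g t 0 x.1.1 (x.2 0) x.1.2))
        - t * affineTest g a b x * (1 - overlap s x.1.1 (x.2 0) (x.2 0) ^ p)
          * gibbsDensity s p g t (n + 1) x := fun x => by
    rw [Fin.sum_univ_succ, ← Finset.sum_mul, ← Finset.mul_sum]
    simp_rw [fun l : Fin n => overlap_comm (s := s) x.1.1 (x.2 0) (x.2 l.succ)]
    ring
  have k1 := (((hasAllMoments_of_bound (P := P) hb hB).mul (hK 0)).add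
    ((HasAllMoments.const t).mul hH)).mul hρ
  have k2 := (HasAllMoments.const (μ := replicaMeasure P (n + 1)) t).mul
    (HasAllMoments.sum Finset.univ fun l _ => j4 l)
  have k3 := (HasAllMoments.const (μ := replicaMeasure P (n + 1)) (t * (n + 1))).mul j5
  simp_rw [e1]
  rw [integral_sub ((k1.add k2).sub k3).integrable j2.integrable, sub_add_cancel,
    integral_sub (k1.add k2).integrable k3.integrable, integral_add k1.integrable k2.integrable,
    integral_const_mul, integral_const_mul, integral_finsetSum _ fun l _ => (j4 l).integrable]

end IsOverlapGaussianProcess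

end TiltedMoments

/-! ### Bounded random vectors are determined by their joint moments. -/

section Moments

variable {α β ι : Type*} [MeasurableSpace α] [MeasurableSpace β] [Finite ι] {μ : Measure α}
  {ν : Measure β} [IsProbabilityMeasure μ] [IsProbabilityMeasure ν] {X : α → ι → ℝ} {Y : β → ι → ℝ}

lemma integrable_comp_of_abs_le_one (hX : Measurable X) (hX1 : ∀ a i, |X a i| ≤ 1)
    {F : (ι → ℝ) → ℝ} (hF : Continuous F) : Integrable (fun a => F (X a)) μ := by
  have hK : IsCompact (Set.univ.pi fun _ : ι => Set.Icc (-1 : ℝ) 1) :=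
    isCompact_univ_pi fun _ => isCompact_Icc
  obtain ⟨C, hC⟩ := hK.exists_bound_of_continuousOn hF.continuousOn
  exact Integrable.of_bound (hF.measurable.comp hX).aestronglyMeasurable C
    (.of_forall fun a => hC _ fun i _ => abs_le.1 (hX1 a i))

/-- Two bounded random vectors with the same joint moments have the same distribution. -/
lemma integral_comp_eq_of_moments (hX : Measurable X) (hY : Measurable Y)
    (hX1 : ∀ a i, |X a i| ≤ 1) (hY1 : ∀ b i, |Y b i| ≤ 1)
    (h : ∀ L : List ι, ∫ a, (L.map (X a)).prod ∂μ = ∫ b, (L.map (Y b)).prod ∂ν)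
    {F : (ι → ℝ) → ℝ} (hF : Continuous F) : ∫ a, F (X a) ∂μ = ∫ b, F (Y b) ∂ν := by
  set e : ι → C(ι → ℝ, ℝ) := fun i => ⟨fun x => x i, continuous_apply i⟩ with he
  -- `A` is the algebra of polynomials in the coordinates, spanned by monomials, on which the
  -- hypothesis gives equality. Stone-Weierstrass on the cube `[-1, 1]^ι` extends it to continuous
  -- functions.
  set A : Subalgebra ℝ C(ι → ℝ, ℝ) := Algebra.adjoin ℝ (Set.range e) with hA
  have hsep : A.SeparatesPoints := by
    intro x y hxy
    obtain ⟨i, hi⟩ := Function.ne_iff.1 hxy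
    exact ⟨e i, ⟨e i, Algebra.subset_adjoin ⟨i, rfl⟩, rfl⟩, hi⟩
  have hint := fun f : C(ι → ℝ, ℝ) => integrable_comp_of_abs_le_one (μ := μ) hX hX1 f.continuous
  have hint' := fun f : C(ι → ℝ, ℝ) => integrable_comp_of_abs_le_one (μ := ν) hY hY1 f.continuous
  have hAeq : ∀ f ∈ A, ∫ a, f (X a) ∂μ = ∫ b, f (Y b) ∂ν := by
    intro f hf
    rw [hA, ← Subalgebra.mem_toSubmodule, Algebra.adjoin_eq_span] at hf
    induction hf using Submodule.span_induction with
    | mem f hf =>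
      obtain ⟨L, hL, rfl⟩ := Submonoid.exists_list_of_mem_closure hf
      obtain ⟨L', rfl⟩ : ∃ L' : List ι, L = L'.map e := by
        choose j hj using hL
        refine ⟨L.attach.map fun y => j y.1 y.2, ?_⟩
        rw [List.map_map]
        conv_lhs => rw [← List.attach_map_subtype_val L]
        exact List.map_congr_left fun y _ => (hj y.1 y.2).symm
      have hev : ∀ (L : List ι) (x : ι → ℝ), (L.map e).prod x = (L.map x).prod := fun L x => by
        induction L with
        | nil => simp
        | cons i L ih =>
          rw [List.map_cons, List.prod_cons, List.map_cons, List.prod_cons, ContinuousMap.mul_apply,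
            ih]
          rfl
      simp_rw [hev]
      exact h L'
    | zero => simp
    | add f k _ _ hf hk =>
      simp only [ContinuousMap.add_apply]
      rw [integral_add (hint f) (hint k), integral_add (hint' f) (hint' k), hf, hk]
    | smul c f _ hf =>
      simp only [ContinuousMap.smul_apply, smul_eq_mul, integral_const_mul, hf]
  have hK : IsCompact (Set.univ.pi fun _ : ι => Set.Icc (-1 : ℝ) 1) :=
    isCompact_univ_pi fun _ => isCompact_Icc
  refine eq_of_forall_dist_le fun ε hε => ?_
  obtain ⟨f, hfA, hf⟩ :=
    ContinuousMap.exists_mem_subalgebra_near_continuous_of_isCompact_of_separatesPoints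
      hsep ⟨F, hF⟩ hK (half_pos hε)
  have h1 : |∫ a, F (X a) ∂μ - ∫ a, f (X a) ∂μ| ≤ ε / 2 := by
    rw [← integral_sub (integrable_comp_of_abs_le_one hX hX1 hF) (hint f), ← Real.norm_eq_abs]
    refine (norm_integral_le_of_norm_le_const (C := ε / 2) (.of_forall fun a => ?_)).trans
      (by simp)
    rw [norm_sub_rev]
    exact (hf _ fun i _ => abs_le.1 (hX1 a i)).le
  have h2 : |∫ b, f (Y b) ∂ν - ∫ b, F (Y b) ∂ν| ≤ ε / 2 := by
    rw [← integral_sub (hint' f) (integrable_comp_of_abs_le_one hY hY1 hF), ← Real.norm_eq_abs]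
    refine (norm_integral_le_of_norm_le_const (C := ε / 2) (.of_forall fun b => ?_)).trans
      (by simp)
    exact (hf _ fun i _ => abs_le.1 (hY1 b i)).le
  rw [Real.dist_eq]
  calc _ = |(∫ a, F (X a) ∂μ - ∫ a, f (X a) ∂μ) + (∫ b, f (Y b) ∂ν - ∫ b, F (Y b) ∂ν)| := by
        rw [hAeq f hfA]
        ring_nf
    _ ≤ ε / 2 + ε / 2 := (abs_add_le _ _).trans (add_le_add h1 h2)
    _ = ε := add_halves ε

end Moments

/-! ### From stochastic stability to equality in law of the multi-overlaps. -/

section Stability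

variable {Ω : Type*} {s : I → I → I → ℝ} {p : ℕ} {g : I → I → Ω → ℝ} {t : ℝ}

/-- The products of spins which appear in the stability equations. -/
def spinProduct (s : I → I → I → ℝ) (w : I) {n m : ℕ} (S : Fin m → Finset (Fin n)) (u : Fin n → I)
    (v : Fin m → I) : ℝ :=
  ∏ l, ∏ i ∈ Finset.univ.filter (fun i => l ∈ S i), s w (u l) (v i)

lemma spinProduct_eq {n m : ℕ} (S : Fin m → Finset (Fin n)) (w : I) (u : Fin n → I)
    (v : Fin m → I) : spinProduct s w S u v = ∏ i, ∏ l ∈ S i, s w (u l) (v i) := by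
  refine Finset.prod_comm' fun l i => ?_
  simp

lemma integral_spinProduct {n m : ℕ} (S : Fin m → Finset (Fin n)) (w : I) (u : Fin n → I) :
    ∫ v, spinProduct s w S u v = ∏ i, multiOverlap s w u (S i) := by
  simp_rw [spinProduct_eq]
  exact integral_fintype_prod_volume_eq_prod fun i v => ∏ l ∈ S i, s w (u l) v

lemma abs_spinProduct_le_one (hs : ∀ w u v, s w u v ∈ Set.Icc (-1 : ℝ) 1) {n m : ℕ}
    (S : Fin m → Finset (Fin n)) (w : I) (u : Fin n → I) (v : Fin m → I) :
    |spinProduct s w S u v| ≤ 1 := by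
  rw [spinProduct, Finset.abs_prod]
  refine Finset.prod_le_one (fun _ _ => abs_nonneg _) fun l _ => ?_
  rw [Finset.abs_prod]
  exact Finset.prod_le_one (fun _ _ => abs_nonneg _) fun i _ => abs_le.2 (hs _ _ _)

lemma measurable_spinProduct (hsm : Measurable fun x : I × I × I => s x.1 x.2.1 x.2.2) {n m : ℕ}
    (S : Fin m → Finset (Fin n)) :
    Measurable fun x : I × (Fin n → I) × (Fin m → I) => spinProduct s x.1 S x.2.1 x.2.2 := by
  refine Finset.measurable_fun_prod _ fun l _ => Finset.measurable_fun_prod _ fun i _ => ?_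
  exact hsm.comp (g := fun x : I × I × I => s x.1 x.2.1 x.2.2)
    (f := fun x : I × (Fin n → I) × (Fin m → I) => (x.1, x.2.1 l, x.2.2 i)) (by fun_prop)

lemma measurable_multiOverlap (hsm : Measurable fun x : I × I × I => s x.1 x.2.1 x.2.2) (n : ℕ) :
    Measurable fun x : I × (Fin n → I) => multiOverlap s x.1 x.2 := by
  refine measurable_pi_lambda _ fun S => ?_
  have : Measurable fun x : (I × (Fin n → I)) × I => ∏ l ∈ S, s x.1.1 (x.1.2 l) x.2 := by
    refine Finset.measurable_fun_prod _ fun l _ => ?_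
    exact hsm.comp (g := fun x : I × I × I => s x.1 x.2.1 x.2.2)
      (f := fun x : (I × (Fin n → I)) × I => (x.1.1, x.1.2 l, x.2)) (by fun_prop)
  exact this.stronglyMeasurable.integral_prod_right'.measurable

variable [MeasurableSpace Ω] {P : Measure Ω}

/-- The law of the environment and of `n` replicas sampled from the Gibbs measure. -/
def gibbsMeasure (P : Measure Ω) (s : I → I → I → ℝ) (p : ℕ) (g : I → I → Ω → ℝ) (t : ℝ) (n : ℕ) :
    Measure ((I × Ω) × (Fin n → I)) :=
  (replicaMeasure P n).withDensity fun x => ENNReal.ofReal (gibbsDensity s p g t n x)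

lemma integral_gibbsMeasure (hg : IsOverlapGaussianProcess P s p g)
    (hsm : Measurable fun x : I × I × I => s x.1 x.2.1 x.2.2) {n : ℕ}
    (f : (I × Ω) × (Fin n → I) → ℝ) :
    ∫ x, f x ∂(gibbsMeasure P s p g t n)
      = ∫ x, f x * gibbsDensity s p g t n x ∂(replicaMeasure P n) := by
  rw [gibbsMeasure, integral_withDensity_eq_integral_toReal_smul
    (measurable_gibbsDensity hsm hg.measurable n).ennreal_ofReal (by simp)]
  refine integral_congr_ae (.of_forall fun x => ?_)
  simp only [ENNReal.toReal_ofReal (gibbsDensity_nonneg x), smul_eq_mul, mul_comm]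

variable [IsProbabilityMeasure P]

/-- Stochastic stability for the monomials in the multi-overlaps. -/
lemma StochasticallyStableAt.integral_prod_multiOverlap (hstab : StochasticallyStableAt P s p g t)
    (hg : IsOverlapGaussianProcess P s p g)
    (hsm : Measurable fun x : I × I × I => s x.1 x.2.1 x.2.2)
    (hs : ∀ w u v, s w u v ∈ Set.Icc (-1 : ℝ) 1) {n m : ℕ} (hn : 1 ≤ n) (hm : 1 ≤ m)
    (S : Fin m → Finset (Fin n)) :
    ∫ x, (∏ i, multiOverlap s x.1.1 x.2 (S i)) * gibbsDensity s p g t n x ∂(replicaMeasure P n)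
      = ∫ w : I, ∫ u : Fin n → I, ∏ i, multiOverlap s w u (S i) := by
  -- The incidence relation between replicas and spins is transposed: stability groups spins by
  -- replica (`C_l`), multi-overlaps group replicas by spin (`S i`).
  have h := hstab n hn m hm fun l => Finset.univ.filter fun i => l ∈ S i
  have hL : ∀ w : I, ∫ v : Fin m → I, ∏ l : Fin n, replicaE (fun u _ =>
        ∏ i ∈ Finset.univ.filter (fun i => l ∈ S i), s w u (v i))
      = ∫ u : Fin n → I, ∏ i, multiOverlap s w u (S i) := fun w => by
    have hint : Integrable (fun x : (Fin m → I) × (Fin n → I) => spinProduct s w S x.2 x.1)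
        (volume.prod volume) :=
      .of_bound ((measurable_spinProduct hsm S).comp
        (g := fun x : I × (Fin n → I) × (Fin m → I) => spinProduct s x.1 S x.2.1 x.2.2)
        (f := fun x : (Fin m → I) × (Fin n → I) => (w, x.2, x.1)) (by fun_prop)).aestronglyMeasurable
        1 (.of_forall fun _ => abs_spinProduct_le_one hs _ _ _ _)
    calc _ = ∫ v : Fin m → I, ∫ u : Fin n → I, spinProduct s w S u v := by
          refine integral_congr_ae (.of_forall fun v => ?_)
          simp only [replicaE, integral_const, probReal_univ, one_smul]
          exact (integral_fintype_prod_volume_eq_prod fun (l : Fin n) u =>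
            ∏ i ∈ Finset.univ.filter (fun i => l ∈ S i), s w u (v i)).symm
      _ = ∫ u : Fin n → I, ∫ v : Fin m → I, spinProduct s w S u v :=
          integral_integral_swap hint
      _ = _ := by simp_rw [integral_spinProduct]
  have hR : ∫ w : I, ∫ v : Fin m → I, ∫ ω,
        (∏ l : Fin n, replicaE fun u z =>
            (∏ i ∈ Finset.univ.filter (fun i => l ∈ S i), s w u (v i))
              * Real.exp (t * bigG s p g w u ω z)) /
          (replicaE fun u z => Real.exp (t * bigG s p g w u ω z)) ^ n ∂P
      = ∫ x, (∏ i, multiOverlap s x.1.1 x.2 (S i)) * gibbsDensity s p g t n x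
          ∂(replicaMeasure P n) := by
    have hρ := (hg.hasAllMoments_gibbsDensity (t := t) hsm hs n).integrable
    -- Reassociation puts `w` outermost. For fixed `w`, Fubini moves the average over `v` inside,
    -- where the independent `v_i` turn the spins into a product of multi-overlaps.
    have hassoc := (measurePreserving_prodAssoc (volume : Measure I) P
      (volume : Measure (Fin n → I))).symm
    have hρ' := hassoc.integrable_comp_of_integrable hρ
    have hmo : Measurable fun x : (I × Ω) × (Fin n → I) =>
        ∏ i, multiOverlap s x.1.1 x.2 (S i) :=
      Finset.measurable_fun_prod _ fun i _ => ((measurable_multiOverlap hsm n).comp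
        (f := fun x : (I × Ω) × (Fin n → I) => (x.1.1, x.2)) (by fun_prop)).eval (a := S i)
    have hmo1 : ∀ x : (I × Ω) × (Fin n → I), |∏ i, multiOverlap s x.1.1 x.2 (S i)| ≤ 1 :=
      fun x => by
        rw [Finset.abs_prod]
        exact Finset.prod_le_one (fun _ _ => abs_nonneg _)
          fun i _ => abs_multiOverlap_le_one hs _ _ _
    have hint : Integrable (fun x => (∏ i, multiOverlap s x.1.1 x.2 (S i))
        * gibbsDensity s p g t n x) (replicaMeasure P n) :=
      hρ.bdd_mul hmo.aestronglyMeasurable (.of_forall hmo1)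
    have hint' := hassoc.integrable_comp_of_integrable hint
    simp only [Function.comp_def] at hint'
    unfold replicaMeasure
    rw [← hassoc.integral_comp (MeasurableEquiv.measurableEmbedding _), integral_prod _ hint']
    refine integral_congr_ae ?_
    filter_upwards [hρ'.prod_right_ae] with w hw
    have hw' : Integrable (fun y : Ω × (Fin n → I) => gibbsDensity s p g t n ((w, y.1), y.2))
      (P.prod volume) := hw
    have hspin : Measurable fun y : (Fin m → I) × Ω × (Fin n → I) =>
        spinProduct s w S y.2.2 y.1 := (measurable_spinProduct hsm S).comp
        (g := fun x : I × (Fin n → I) × (Fin m → I) => spinProduct s x.1 S x.2.1 x.2.2)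
        (f := fun y : (Fin m → I) × Ω × (Fin n → I) => (w, y.2.2, y.1)) (by fun_prop)
    have hjoint : Integrable (fun y : (Fin m → I) × Ω × (Fin n → I) =>
        spinProduct s w S y.2.2 y.1 * gibbsDensity s p g t n ((w, y.2.1), y.2.2))
        (volume.prod (P.prod volume)) :=
      (hw'.comp_snd volume).bdd_mul hspin.aestronglyMeasurable
        (.of_forall fun _ => abs_spinProduct_le_one hs _ _ _ _)
    calc _ = ∫ v : Fin m → I, ∫ ω, (∫ u : Fin n → I,
            spinProduct s w S u v * gibbsDensity s p g t n ((w, ω), u)) ∂P := by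
          refine integral_congr_ae (.of_forall fun v => integral_congr_ae (.of_forall fun ω => ?_))
          simp_rw [replicaE_exp hs, replicaE_mul_exp hs]
          exact (integral_prod_mul_gibbsDensity (fun (l : Fin n) u =>
            ∏ i ∈ Finset.univ.filter (fun i => l ∈ S i), s w u (v i)) (w, ω)).symm
      _ = ∫ v : Fin m → I, ∫ y : Ω × (Fin n → I),
            spinProduct s w S y.2 v * gibbsDensity s p g t n ((w, y.1), y.2) ∂(P.prod volume) := by
          refine integral_congr_ae ?_
          filter_upwards [hjoint.prod_right_ae] with v hv
          rw [integral_prod _ hv]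
      _ = ∫ y : Ω × (Fin n → I), (∫ v : Fin m → I,
            spinProduct s w S y.2 v * gibbsDensity s p g t n ((w, y.1), y.2)) ∂(P.prod volume) :=
          integral_integral_swap hjoint
      _ = _ := by
          refine integral_congr_ae (.of_forall fun y => ?_)
          dsimp only
          rw [integral_mul_const, integral_spinProduct]
          rfl
  rw [← hR]
  refine h.symm.trans ?_
  simp_rw [hL]

lemma isProbabilityMeasure_gibbsMeasure (hg : IsOverlapGaussianProcess P s p g)
    (hsm : Measurable fun x : I × I × I => s x.1 x.2.1 x.2.2)
    (hs : ∀ w u v, s w u v ∈ Set.Icc (-1 : ℝ) 1) (n : ℕ) :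
    IsProbabilityMeasure (gibbsMeasure P s p g t (n + 1)) := by
  constructor
  rw [gibbsMeasure, withDensity_apply _ MeasurableSet.univ, setLIntegral_univ,
    ← ofReal_integral_eq_lintegral_ofReal (hg.hasAllMoments_gibbsDensity hsm hs (n + 1)).integrable
      (.of_forall gibbsDensity_nonneg), hg.integral_gibbsDensity hsm hs n]
  simp

/-- Stochastic stability: the multi-overlaps have the same distribution under the Gibbs measure. -/
theorem StochasticallyStableAt.integral_multiOverlap (hstab : StochasticallyStableAt P s p g t)
    (hg : IsOverlapGaussianProcess P s p g)
    (hsm : Measurable fun x : I × I × I => s x.1 x.2.1 x.2.2)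
    (hs : ∀ w u v, s w u v ∈ Set.Icc (-1 : ℝ) 1) {n : ℕ} {F : (Finset (Fin (n + 1)) → ℝ) → ℝ}
    (hF : Continuous F) :
    ∫ x, F (multiOverlap s x.1.1 x.2) * gibbsDensity s p g t (n + 1) x ∂(replicaMeasure P (n + 1))
      = ∫ w : I, ∫ u : Fin (n + 1) → I, F (multiOverlap s w u) := by
  have := isProbabilityMeasure_gibbsMeasure (t := t) hg hsm hs n
  have hm := measurable_multiOverlap hsm (n + 1)
  have hint : ∀ F : (Finset (Fin (n + 1)) → ℝ) → ℝ, Continuous F →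
      Integrable (fun x : I × (Fin (n + 1) → I) => F (multiOverlap s x.1 x.2))
        (volume.prod volume) := fun F hF =>
    integrable_comp_of_abs_le_one hm (fun _ _ => abs_multiOverlap_le_one hs _ _ _) hF
  have h := integral_comp_eq_of_moments (μ := gibbsMeasure P s p g t (n + 1))
    (ν := (volume : Measure I).prod (volume : Measure (Fin (n + 1) → I)))
    (X := fun x => multiOverlap s x.1.1 x.2) (Y := fun x => multiOverlap s x.1 x.2)
    (hm.comp (f := fun x : (I × Ω) × (Fin (n + 1) → I) => (x.1.1, x.2)) (by fun_prop)) hm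
    (fun _ _ => abs_multiOverlap_le_one hs _ _ _) (fun _ _ => abs_multiOverlap_le_one hs _ _ _)
    (fun L => ?_) hF
  · rw [← integral_gibbsMeasure hg hsm, h, integral_prod _ (hint F hF)]
  -- Stability is stated for `m ≥ 1`; the empty monomial only compares total masses.
  · rcases Nat.eq_zero_or_pos L.length with hL | hL
    · rw [List.length_eq_zero_iff.1 hL]
      simp
    · have hprod : ∀ f : Finset (Fin (n + 1)) → ℝ, (L.map f).prod = ∏ i : Fin L.length, f (L.get i) :=
        fun f => by simp [← List.prod_ofFn]
      simp only [hprod]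
      rw [integral_gibbsMeasure hg hsm, integral_prod _ (hint (fun r => ∏ i, r (L.get i))
        (by fun_prop))]
      exact hstab.integral_prod_multiOverlap hg hsm hs (by omega) hL L.get

end Stability

/-! ### The Ghirlanda-Guerra identities as vanishing defects. -/

section Defect

variable {s : I → I → I → ℝ} {p : ℕ}

/-- The mean `𝔼 R_{1,2}^p`. -/
def overlapMean (s : I → I → I → ℝ) (p : ℕ) : ℝ :=
  ∫ w : I, ∫ u : I, ∫ u' : I, overlap s w u u' ^ p

/-- The mean of a function of the multi-overlaps of `n` replicas. -/
def replicaMean (s : I → I → I → ℝ) {n : ℕ} (F : (Finset (Fin n) → ℝ) → ℝ) : ℝ :=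
  ∫ w : I, ∫ u : Fin n → I, F (multiOverlap s w u)

/-- A function of the first `n` replicas times the `p`-th power of the overlap of the first and the
last of `n + 1` replicas. -/
def mulLastOverlap (p : ℕ) {n : ℕ} (F : (Finset (Fin (n + 1)) → ℝ) → ℝ) :
    (Finset (Fin (n + 2)) → ℝ) → ℝ :=
  fun r => F (fun S => r (S.map Fin.castSuccEmb)) * r {0, Fin.last (n + 1)} ^ p

/-- The defect in the Ghirlanda-Guerra identity for the function `F` of `n + 1` replicas. -/
def ggDefect (s : I → I → I → ℝ) (p : ℕ) {n : ℕ} (F : (Finset (Fin (n + 1)) → ℝ) → ℝ) : ℝ :=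
  replicaMean s F * overlapMean s p
    + ∑ l : Fin n, replicaMean s (fun r => F r * r {0, l.succ} ^ p)
    - (n + 1) * replicaMean s (mulLastOverlap p F)

lemma continuous_mulLastOverlap {n : ℕ} {F : (Finset (Fin (n + 1)) → ℝ) → ℝ} (hF : Continuous F) :
    Continuous (mulLastOverlap p F) := by
  unfold mulLastOverlap
  fun_prop

lemma multiOverlap_castSucc {n : ℕ} (w : I) (u : Fin (n + 1) → I) :
    multiOverlap s w (fun l : Fin n => u l.castSucc)
      = fun S => multiOverlap s w u (S.map Fin.castSuccEmb) := by
  ext S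
  simp [multiOverlap]

lemma mulLastOverlap_multiOverlap {n : ℕ} (F : (Finset (Fin (n + 1)) → ℝ) → ℝ) (w : I)
    (u : Fin (n + 2) → I) :
    mulLastOverlap p F (multiOverlap s w u)
      = F (multiOverlap s w fun l => u l.castSucc)
        * overlap s w (u 0) (u (Fin.last (n + 1))) ^ p := by
  rw [mulLastOverlap, multiOverlap_castSucc,
    overlap_eq_multiOverlap w u (i := 0) (j := Fin.last (n + 1)) (Fin.last_pos.ne)]

lemma overlap_zero_succ {n : ℕ} (w : I) (u : Fin (n + 1) → I) (l : Fin n) :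
    overlap s w (u 0) (u l.succ) = multiOverlap s w u {0, l.succ} :=
  overlap_eq_multiOverlap w u (Fin.succ_ne_zero l).symm

lemma integrable_multiOverlap (hsm : Measurable fun x : I × I × I => s x.1 x.2.1 x.2.2)
    (hs : ∀ w u v, s w u v ∈ Set.Icc (-1 : ℝ) 1) {n : ℕ} {F : (Finset (Fin n) → ℝ) → ℝ}
    (hF : Continuous F) (w : I) : Integrable fun u : Fin n → I => F (multiOverlap s w u) :=
  integrable_comp_of_abs_le_one ((measurable_multiOverlap hsm n).comp
    (f := fun u : Fin n → I => (w, u)) (by fun_prop)) (fun _ _ => abs_multiOverlap_le_one hs _ _ _)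
    hF

/-- Removes the idle last replica: `GhirlandaGuerra` writes every term of its sum with one replica
more than `ggDefect` does. -/
lemma integral_comp_castSucc {n : ℕ} {f : (Fin n → I) → ℝ} (hf : Integrable f) :
    ∫ u : Fin (n + 1) → I, f (fun l => u l.castSucc) = ∫ u, f u := by
  have hmp : MeasurePreserving (fun u : Fin (n + 1) → I => fun l : Fin n => u l.castSucc)
      volume volume := by
    have h := measurePreserving_snd.comp
      (volume_preserving_piFinSuccAbove (fun _ : Fin (n + 1) => I) (Fin.last n))
    have heq : (fun u : Fin (n + 1) → I => fun l : Fin n => u l.castSucc)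
        = Prod.snd ∘ MeasurableEquiv.piFinSuccAbove (fun _ => I) (Fin.last n) := by
      funext u l
      simp [MeasurableEquiv.piFinSuccAbove, Fin.init]
    exact heq ▸ h
  rw [← hmp.map_eq] at hf
  conv_rhs => rw [← hmp.map_eq]
  rw [integral_map hmp.measurable.aemeasurable hf.aestronglyMeasurable]

lemma replicaMean_const_one {n : ℕ} :
    replicaMean s (fun _ : Finset (Fin n) → ℝ => 1) = 1 := by
  simp [replicaMean]

lemma integral_pair (hsm : Measurable fun x : I × I × I => s x.1 x.2.1 x.2.2)
    (hs : ∀ w u v, s w u v ∈ Set.Icc (-1 : ℝ) 1) :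
    ∫ w : I, ∫ u : Fin 2 → I, overlap s w (u 0) (u 1) ^ p = overlapMean s p := by
  refine integral_congr_ae (.of_forall fun w => ?_)
  have hint : Integrable fun u : Fin 2 → I => overlap s w (u 0) (u 1) ^ p :=
    .of_bound ((measurable_overlap_comp hsm (by fun_prop) (by fun_prop)
      (by fun_prop)).pow_const p).aestronglyMeasurable 1
      (.of_forall fun _ => abs_overlap_pow_le_one hs p _ _ _)
  dsimp only
  rw [integral_pi_succ hint]
  have hm : AEStronglyMeasurable (fun u : I => ∫ v : I, overlap s w u v ^ p) volume := by
    have : Measurable fun x : I × I => overlap s w x.1 x.2 ^ p :=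
      (measurable_overlap_comp hsm (by fun_prop) (by fun_prop) (by fun_prop)).pow_const p
    exact this.stronglyMeasurable.integral_prod_right'.aestronglyMeasurable
  have hmp := measurePreserving_eval (fun _ : Fin 1 => (volume : Measure I)) 0
  rw [← hmp.map_eq] at hm
  conv_rhs => rw [← hmp.map_eq]
  rw [integral_map hmp.measurable.aemeasurable hm, hmp.map_eq]
  rfl

lemma replicaMean_pair (hsm : Measurable fun x : I × I × I => s x.1 x.2.1 x.2.2)
    (hs : ∀ w u v, s w u v ∈ Set.Icc (-1 : ℝ) 1) :
    replicaMean s (fun r : Finset (Fin 2) → ℝ => r {0, 1} ^ p) = overlapMean s p := by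
  rw [← integral_pair hsm hs, replicaMean]
  refine integral_congr_ae (.of_forall fun w => integral_congr_ae (.of_forall fun u => ?_))
  dsimp only
  rw [overlap_eq_multiOverlap w u (i := 0) (j := 1) (by simp)]

/-- For one replica and `F = 1` the identity is trivial. This makes the mean of `G_p` explicit
without assuming the identities. -/
lemma ggDefect_one (hsm : Measurable fun x : I × I × I => s x.1 x.2.1 x.2.2)
    (hs : ∀ w u v, s w u v ∈ Set.Icc (-1 : ℝ) 1) :
    ggDefect s p (fun _ : Finset (Fin 1) → ℝ => 1) = 0 := by
  have : replicaMean s (mulLastOverlap p fun _ : Finset (Fin 1) → ℝ => 1) = overlapMean s p := by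
    rw [← replicaMean_pair hsm hs]
    refine congrArg _ (funext fun r => ?_)
    exact one_mul _
  simp [ggDefect, this, replicaMean_const_one]

lemma ghirlandaGuerra_iff (hsm : Measurable fun x : I × I × I => s x.1 x.2.1 x.2.2)
    (hs : ∀ w u v, s w u v ∈ Set.Icc (-1 : ℝ) 1) :
    GhirlandaGuerra s ↔ ∀ n p : ℕ, 1 ≤ p → ∀ F : (Finset (Fin (n + 1)) → ℝ) → ℝ, Continuous F →
      ggDefect s p F = 0 := by
  have key : ∀ n p : ℕ, ∀ F : (Finset (Fin (n + 1)) → ℝ) → ℝ, Continuous F →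
      ((∫ w : I, ∫ u : Fin (n + 1 + 1) → I,
        F (multiOverlap s w fun l => u l.castSucc) * overlap s w (u 0) (u (Fin.last (n + 1))) ^ p
      = (1 / ((n + 1 : ℕ) : ℝ)) *
          ((∫ w : I, ∫ u : Fin (n + 1) → I, F (multiOverlap s w u)) *
            ∫ w : I, ∫ u : I, ∫ u' : I, overlap s w u u' ^ p)
        + (1 / ((n + 1 : ℕ) : ℝ)) * ∑ l ∈ Finset.Ioo 0 (Fin.last (n + 1)),
            ∫ w : I, ∫ u : Fin (n + 1 + 1) → I,
              F (multiOverlap s w fun k => u k.castSucc) * overlap s w (u 0) (u l) ^ p)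
      ↔ ggDefect s p F = 0) := by
    intro n p F hF
    have h1 : ∫ w : I, ∫ u : Fin (n + 1 + 1) → I,
        F (multiOverlap s w fun l => u l.castSucc) * overlap s w (u 0) (u (Fin.last (n + 1))) ^ p
        = replicaMean s (mulLastOverlap p F) := by
      rw [replicaMean]
      simp_rw [mulLastOverlap_multiOverlap]
    have h2 : ∑ l ∈ Finset.Ioo 0 (Fin.last (n + 1)), ∫ w : I, ∫ u : Fin (n + 1 + 1) → I,
        F (multiOverlap s w fun k => u k.castSucc) * overlap s w (u 0) (u l) ^ p
        = ∑ l : Fin n, replicaMean s (fun r => F r * r {0, l.succ} ^ p) := by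
      symm
      -- The sum over the replicas strictly between the first and the additional one is reindexed by
      -- `Fin n`.
      refine Finset.sum_bij (fun l _ => l.succ.castSucc) (fun l _ => ?_) (fun l _ l' _ h => ?_)
        (fun l hl => ?_) (fun l _ => ?_)
      · simp [Finset.mem_Ioo, Fin.lt_def]
      · simpa using h
      · obtain ⟨h0, h1⟩ := Finset.mem_Ioo.1 hl
        have h0' : 0 < l.val := h0
        have h1' : l.val < n + 1 := h1
        refine ⟨⟨l.val - 1, by omega⟩, Finset.mem_univ _, ?_⟩
        ext
        simp only [Fin.val_castSucc, Fin.val_succ]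
        omega
      · refine integral_congr_ae (.of_forall fun w => ?_)
        dsimp only
        rw [← integral_comp_castSucc (f := fun u : Fin (n + 1) → I =>
          F (multiOverlap s w u) * multiOverlap s w u {0, l.succ} ^ p)
          (integrable_multiOverlap hsm hs (F := fun r => F r * r {0, l.succ} ^ p)
            (by fun_prop) w)]
        refine integral_congr_ae (.of_forall fun u => ?_)
        dsimp only
        rw [← overlap_zero_succ]
        rfl
    rw [h1, h2, ggDefect]
    change _ = _ * (replicaMean s F * overlapMean s p) + _ ↔ _
    have hn : ((n : ℝ) + 1) ≠ 0 := by positivity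
    push_cast
    constructor
    · intro h
      rw [h]
      field_simp
      ring
    · intro h
      field_simp
      linarith
  constructor
  · intro h n p hp F hF
    exact (key n p F hF).1 (h (n + 1) (by omega) p hp F hF)
  · intro h n hn p hp F hF
    obtain ⟨n, rfl⟩ := Nat.exists_eq_add_of_le' hn
    exact (key n p F hF).2 (h n p hp F hF)

end Defect

/-! ### The mean and variance of `G_p` in terms of the defect. -/

section Variance

variable {Ω : Type*} [MeasurableSpace Ω] {P : Measure Ω} [IsProbabilityMeasure P]
  {s : I → I → I → ℝ} {p : ℕ} {g : I → I → Ω → ℝ} {t : ℝ}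

open IsOverlapGaussianProcess

lemma exists_abs_comp_multiOverlap_le (hs : ∀ w u v, s w u v ∈ Set.Icc (-1 : ℝ) 1) {n : ℕ}
    {F : (Finset (Fin n) → ℝ) → ℝ} (hF : Continuous F) :
    ∃ C, ∀ y : I × (Fin n → I), |F (multiOverlap s y.1 y.2)| ≤ C := by
  have hK : IsCompact (Set.univ.pi fun _ : Finset (Fin n) => Set.Icc (-1 : ℝ) 1) :=
    isCompact_univ_pi fun _ => isCompact_Icc
  obtain ⟨C, hC⟩ := hK.exists_bound_of_continuousOn hF.continuousOn
  exact ⟨C, fun y => hC _ fun S _ => abs_le.1 (abs_multiOverlap_le_one hs _ _ _)⟩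

/-- Gaussian integration by parts, for a stochastically stable function of the multi-overlaps. -/
theorem integral_multiOverlap_mul_tiltedField (hstab : StochasticallyStableAt P s p g t)
    (hg : IsOverlapGaussianProcess P s p g)
    (hsm : Measurable fun x : I × I × I => s x.1 x.2.1 x.2.2)
    (hs : ∀ w u v, s w u v ∈ Set.Icc (-1 : ℝ) 1) {n : ℕ} {F : (Finset (Fin (n + 1)) → ℝ) → ℝ}
    (hF : Continuous F) :
    ∫ x, F (multiOverlap s x.1.1 x.2) * tiltedField s p g t x.1.1 (x.2 0) x.1.2
        * gibbsDensity s p g t (n + 1) x ∂(replicaMeasure P (n + 1))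
      = t * (replicaMean s F * (1 - overlapMean s p) + ggDefect s p F) := by
  obtain ⟨C, hC⟩ := exists_abs_comp_multiOverlap_le hs hF
  -- With `b = 0` no self-overlap survives. All remaining terms involve multi-overlaps of distinct
  -- replicas, to which stability applies.
  have h := hg.integral_affineTest_mul_tiltedField (t := t) hsm hs
    (a := fun y => F (multiOverlap s y.1 y.2)) (b := fun _ => 0)
    (hF.measurable.comp (measurable_multiOverlap hsm (n + 1))) hC measurable_const
    (B := 0) (by simp)
  simp only [affineTest, zero_mul, add_zero, zero_add] at h
  rw [h]
  have h1 := hstab.integral_multiOverlap hg hsm hs (F := fun r => t * F r) (by fun_prop)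
  have h2 : ∀ l : Fin n, ∫ x : (I × Ω) × (Fin (n + 1) → I), F (multiOverlap s x.1.1 x.2)
        * overlap s x.1.1 (x.2 0) (x.2 l.succ) ^ p * gibbsDensity s p g t (n + 1) x
        ∂(replicaMeasure P (n + 1)) = replicaMean s (fun r => F r * r {0, l.succ} ^ p) := fun l => by
    rw [replicaMean, ← hstab.integral_multiOverlap hg hsm hs
      (F := fun r => F r * r {0, l.succ} ^ p) (by fun_prop)]
    simp_rw [overlap_zero_succ]
  have h3 := hstab.integral_multiOverlap hg hsm hs (n := n + 1)
    (continuous_mulLastOverlap (p := p) hF)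
  simp only [mulLastOverlap_multiOverlap] at h3
  rw [h1, h3]
  simp only [h2, integral_const_mul]
  rw [ggDefect]
  simp only [replicaMean, mulLastOverlap_multiOverlap]
  ring

lemma tiltedMoment_one (hstab : StochasticallyStableAt P s p g t)
    (hg : IsOverlapGaussianProcess P s p g)
    (hsm : Measurable fun x : I × I × I => s x.1 x.2.1 x.2.2)
    (hs : ∀ w u v, s w u v ∈ Set.Icc (-1 : ℝ) 1) :
    tiltedMoment P s p g t 1 = t * (1 - overlapMean s p) := by
  have h := integral_multiOverlap_mul_tiltedField hstab hg hsm hs (n := 0) (F := fun _ => 1)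
    continuous_const
  simp only [one_mul, replicaMean_const_one, ggDefect_one hsm hs, add_zero] at h
  rw [hg.tiltedMoment_one_eq hsm hs 0, h]

/-- The variance of `G_p` under the tilted measure, in terms of a single Ghirlanda-Guerra
defect. -/
theorem tiltedVariance_eq (hstab : StochasticallyStableAt P s p g t)
    (hg : IsOverlapGaussianProcess P s p g)
    (hsm : Measurable fun x : I × I × I => s x.1 x.2.1 x.2.2)
    (hs : ∀ w u v, s w u v ∈ Set.Icc (-1 : ℝ) 1) :
    tiltedVariance P s p g t
      = 1 - t ^ 2 * ggDefect s p (fun r : Finset (Fin 2) → ℝ => r {0, 1} ^ p) := by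
  have hX := hg.hasAllMoments_tiltedField (n := 0) (t := t) hsm hs
  have hρ := hg.hasAllMoments_gibbsDensity (t := t) hsm hs 1
  have hD := hasAllMoments_one_sub_overlap_self (P := P) (n := 0) (p := p) hsm hs
  -- With these coefficients the test function is the field, so the left side is its second moment.
  -- The term with the additional replica is then integrated by parts again in `h2`.
  have h := hg.integral_affineTest_mul_tiltedField (n := 0) (t := t) hsm hs
    (a := fun y => t * (1 - overlap s y.1 (y.2 0) (y.2 0) ^ p)) (b := fun _ => 1)
    (A := |t| * 2) (B := 1)
    ((((measurable_overlap_comp hsm (by fun_prop) (by fun_prop)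
      (by fun_prop)).pow_const p).const_sub 1).const_mul t)
    (fun y => by
      rw [abs_mul]
      gcongr
      refine (abs_sub _ _).trans ?_
      have := abs_overlap_pow_le_one hs p y.1 (y.2 0) (y.2 0)
      rw [abs_one]
      linarith) measurable_const (by simp)
  simp only [← tiltedField_eq_affineTest] at h
  have h2 := integral_multiOverlap_mul_tiltedField hstab hg hsm hs (n := 1)
    (F := fun r => r {0, 1} ^ p) (by fun_prop)
  have h2' : ∫ x : (I × Ω) × (Fin 2 → I), tiltedField s p g t x.1.1 (x.2 0) x.1.2
        * overlap s x.1.1 (x.2 0) (x.2 (Fin.last 1)) ^ p * gibbsDensity s p g t 2 x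
        ∂(replicaMeasure P 2)
      = t * (overlapMean s p * (1 - overlapMean s p)
        + ggDefect s p (fun r : Finset (Fin 2) → ℝ => r {0, 1} ^ p)) := by
    rw [replicaMean_pair hsm hs] at h2
    rw [← h2]
    refine integral_congr_ae (.of_forall fun x => ?_)
    dsimp only
    rw [mul_comm (tiltedField _ _ _ _ _ _ _),
      overlap_eq_multiOverlap x.1.1 x.2 (i := 0) (j := Fin.last 1) (by simp)]
    rfl
  have h1 := tiltedMoment_one hstab hg hsm hs
  have h1' := hg.tiltedMoment_one_eq (t := t) hsm hs 0
  have hmass := hg.integral_gibbsDensity (t := t) hsm hs 0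
  have h3 := h.trans (congrArg (fun z => _ - t * (((0 : ℕ) : ℝ) + 1) * z) h2')
  have i1 := ((hX.mul hX).mul hρ)
  have i2 := hD.mul hρ
  have hsum : tiltedMoment P s p g t 2
      = ∫ x : (I × Ω) × (Fin 1 → I), tiltedField s p g t x.1.1 (x.2 0) x.1.2
          * tiltedField s p g t x.1.1 (x.2 0) x.1.2 * gibbsDensity s p g t 1 x
          ∂(replicaMeasure P 1)
        + ∫ x : (I × Ω) × (Fin 1 → I), (1 - overlap s x.1.1 (x.2 0) (x.2 0) ^ p)
          * gibbsDensity s p g t 1 x ∂(replicaMeasure P 1) := by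
    rw [hg.tiltedMoment_two_eq hsm hs 0, ← integral_add i1.integrable i2.integrable]
    simp only [sq, add_mul]
  -- The Gibbs average of the self-overlap is not governed by stability. It is isolated here because
  -- it cancels against the conditional variance of `z` in `hsum`.
  have hsplit : ∫ x : (I × Ω) × (Fin 1 → I), (1 * overlap s x.1.1 (x.2 0) (x.2 0) ^ p
        + t * tiltedField s p g t x.1.1 (x.2 0) x.1.2) * gibbsDensity s p g t 1 x
          ∂(replicaMeasure P 1)
      = 1 + t * (t * (1 - overlapMean s p)) - ∫ x : (I × Ω) × (Fin 1 → I),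
          (1 - overlap s x.1.1 (x.2 0) (x.2 0) ^ p) * gibbsDensity s p g t 1 x
          ∂(replicaMeasure P 1) := by
    have e : ∀ x : (I × Ω) × (Fin 1 → I), (1 * overlap s x.1.1 (x.2 0) (x.2 0) ^ p
        + t * tiltedField s p g t x.1.1 (x.2 0) x.1.2) * gibbsDensity s p g t 1 x
        = gibbsDensity s p g t 1 x
          + t * (tiltedField s p g t x.1.1 (x.2 0) x.1.2 * gibbsDensity s p g t 1 x)
          - (1 - overlap s x.1.1 (x.2 0) (x.2 0) ^ p) * gibbsDensity s p g t 1 x :=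
      fun x => by ring
    have i3 := (HasAllMoments.const (μ := replicaMeasure P 1) t).mul (hX.mul hρ)
    simp_rw [e]
    rw [integral_sub (hρ.add i3).integrable i2.integrable, integral_add hρ.integrable i3.integrable,
      integral_const_mul, hmass, ← h1, h1']
  rw [tiltedVariance, hsum, h1, h3, hsplit]
  simp only [Finset.univ_eq_empty, Finset.sum_empty]
  push_cast
  ring

/-- Nonnegativity of the variance of `f` under the probability density `ρ`. -/
lemma sq_integral_mul_le {α : Type*} [MeasurableSpace α] {μ : Measure α} [IsFiniteMeasure μ]
    {f ρ : α → ℝ} (hf : HasAllMoments f μ) (hρ : HasAllMoments ρ μ) (hρ0 : ∀ x, 0 ≤ ρ x)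
    (hρ1 : ∫ x, ρ x ∂μ = 1) : (∫ x, f x * ρ x ∂μ) ^ 2 ≤ ∫ x, f x ^ 2 * ρ x ∂μ := by
  set c := ∫ x, f x * ρ x ∂μ with hc
  have h : 0 ≤ ∫ x, (f x - c) ^ 2 * ρ x ∂μ :=
    integral_nonneg fun x => mul_nonneg (sq_nonneg _) (hρ0 x)
  have e : ∀ x, (f x - c) ^ 2 * ρ x = f x ^ 2 * ρ x - 2 * c * (f x * ρ x) + c ^ 2 * ρ x :=
    fun x => by ring
  have i1 := (hf.pow 2).mul hρ
  have i2 := (HasAllMoments.const (2 * c)).mul (hf.mul hρ)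
  have i3 := (HasAllMoments.const (c ^ 2)).mul hρ
  simp_rw [e] at h
  rw [integral_add (i1.sub i2).integrable i3.integrable, integral_sub i1.integrable i2.integrable,
    integral_const_mul, integral_const_mul, hρ1, ← hc] at h
  linarith

end Variance

/-! ### Bounded variance forces every defect to vanish. -/

section Converse

variable {Ω : Type*} [MeasurableSpace Ω] {P : Measure Ω} [IsProbabilityMeasure P]
  {s : I → I → I → ℝ} {p : ℕ} {g : I → I → Ω → ℝ} {t : ℝ}

open IsOverlapGaussianProcess

/-- The fluctuations of `G_p` under the tilted measure control the Ghirlanda-Guerra defects. -/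
theorem sq_mul_ggDefect_le (hstab : StochasticallyStableAt P s p g t)
    (hg : IsOverlapGaussianProcess P s p g)
    (hsm : Measurable fun x : I × I × I => s x.1 x.2.1 x.2.2)
    (hs : ∀ w u v, s w u v ∈ Set.Icc (-1 : ℝ) 1) {n : ℕ} {F : (Finset (Fin (n + 1)) → ℝ) → ℝ}
    (hF : Continuous F) {C : ℝ} (hC : ∀ y : I × (Fin (n + 1) → I), |F (multiOverlap s y.1 y.2)| ≤ C) :
    (t * ggDefect s p F) ^ 2 ≤ C ^ 2 * tiltedVariance P s p g t := by
  set X : (I × Ω) × (Fin (n + 1) → I) → ℝ := fun x => tiltedField s p g t x.1.1 (x.2 0) x.1.2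
    with hXdef
  set m : ℝ := tiltedMoment P s p g t 1 with hm
  have hX : HasAllMoments X (replicaMeasure P (n + 1)) := hg.hasAllMoments_tiltedField hsm hs
  have hρ := hg.hasAllMoments_gibbsDensity (t := t) hsm hs (n + 1)
  have hmass := hg.integral_gibbsDensity (t := t) hsm hs n
  have hFm : HasAllMoments (fun x : (I × Ω) × (Fin (n + 1) → I) => F (multiOverlap s x.1.1 x.2))
      (replicaMeasure P (n + 1)) :=
    hasAllMoments_of_bound (f := fun y => F (multiOverlap s y.1 y.2))
      (hF.measurable.comp (measurable_multiOverlap hsm (n + 1))) hC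
  have hXm : HasAllMoments (fun x => X x - m) (replicaMeasure P (n + 1)) :=
    hX.sub (HasAllMoments.const m)
  -- Centering by `m = t (1 - 𝔼R_{0,1}^p)` removes precisely the term proportional to `𝔼F`.
  have hdefect : ∫ x, F (multiOverlap s x.1.1 x.2) * (X x - m) * gibbsDensity s p g t (n + 1) x
      ∂(replicaMeasure P (n + 1)) = t * ggDefect s p F := by
    have e : ∀ x : (I × Ω) × (Fin (n + 1) → I),
        F (multiOverlap s x.1.1 x.2) * (X x - m) * gibbsDensity s p g t (n + 1) x
        = F (multiOverlap s x.1.1 x.2) * X x * gibbsDensity s p g t (n + 1) x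
          - m * (F (multiOverlap s x.1.1 x.2) * gibbsDensity s p g t (n + 1) x) := fun x => by ring
    simp_rw [e]
    rw [integral_sub ((hFm.mul hX).mul hρ).integrable
      ((HasAllMoments.const m).mul (hFm.mul hρ)).integrable, integral_const_mul,
      integral_multiOverlap_mul_tiltedField hstab hg hsm hs hF,
      hstab.integral_multiOverlap hg hsm hs hF, hm, tiltedMoment_one hstab hg hsm hs, replicaMean]
    ring
  -- `X` is `G_p` averaged over `z`, so its variance is smaller by the mean of `1 - R₀₀^p ≥ 0`.
  have hvar : ∫ x, (X x - m) ^ 2 * gibbsDensity s p g t (n + 1) x ∂(replicaMeasure P (n + 1))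
      ≤ tiltedVariance P s p g t := by
    have hD := hasAllMoments_one_sub_overlap_self (P := P) (n := n) (p := p) hsm hs
    have e : ∀ x : (I × Ω) × (Fin (n + 1) → I), (X x - m) ^ 2 * gibbsDensity s p g t (n + 1) x
        = X x ^ 2 * gibbsDensity s p g t (n + 1) x
          - 2 * m * (X x * gibbsDensity s p g t (n + 1) x)
          + m ^ 2 * gibbsDensity s p g t (n + 1) x := fun x => by ring
    have i1 := (hX.pow 2).mul hρ
    have i2 := (HasAllMoments.const (2 * m)).mul (hX.mul hρ)
    have i3 := (HasAllMoments.const (m ^ 2)).mul hρ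
    have hle : ∫ x, X x ^ 2 * gibbsDensity s p g t (n + 1) x ∂(replicaMeasure P (n + 1))
        ≤ tiltedMoment P s p g t 2 := by
      rw [hg.tiltedMoment_two_eq hsm hs n]
      refine integral_mono i1.integrable (((hX.pow 2).add hD).mul hρ).integrable fun x => ?_
      have := (abs_le.1 (abs_overlap_pow_le_one hs p x.1.1 (x.2 0) (x.2 0))).2
      exact mul_le_mul_of_nonneg_right (le_add_of_nonneg_right (sub_nonneg.2 this))
        (gibbsDensity_nonneg x)
    simp_rw [e]
    rw [integral_add (i1.sub i2).integrable i3.integrable, integral_sub i1.integrable i2.integrable,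
      integral_const_mul, integral_const_mul, hmass, ← hg.tiltedMoment_one_eq hsm hs n,
      tiltedVariance, ← hm]
    linarith
  calc (t * ggDefect s p F) ^ 2
      ≤ ∫ x, (F (multiOverlap s x.1.1 x.2) * (X x - m)) ^ 2 * gibbsDensity s p g t (n + 1) x
        ∂(replicaMeasure P (n + 1)) := by
        rw [← hdefect]
        exact sq_integral_mul_le (hFm.mul hXm) hρ gibbsDensity_nonneg hmass
    _ ≤ ∫ x, C ^ 2 * ((X x - m) ^ 2 * gibbsDensity s p g t (n + 1) x)
        ∂(replicaMeasure P (n + 1)) := by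
        refine integral_mono (((hFm.mul hXm).pow 2).mul hρ).integrable
          ((HasAllMoments.const (C ^ 2)).mul ((hXm.pow 2).mul hρ)).integrable fun x => ?_
        dsimp only
        rw [mul_pow, mul_assoc]
        exact mul_le_mul_of_nonneg_right (sq_le_sq' (abs_le.1 (hC (x.1.1, x.2))).1
          (abs_le.1 (hC (x.1.1, x.2))).2) (mul_nonneg (sq_nonneg _) (gibbsDensity_nonneg x))
    _ ≤ C ^ 2 * tiltedVariance P s p g t := by
        rw [integral_const_mul]
        gcongr

lemma eq_zero_of_forall_sq_mul_le {x B : ℝ} (h : ∀ t : ℝ, 0 < t → (t * x) ^ 2 ≤ B) : x = 0 := by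
  by_contra hx
  have hB : 0 ≤ B := (sq_nonneg _).trans (h 1 one_pos)
  -- At `t = (B + 1) / |x|` the hypothesis would read `(B + 1)² ≤ B`.
  have hpos : 0 < (B + 1) / |x| := div_pos (by linarith) (abs_pos.2 hx)
  have := h _ hpos
  rw [← sq_abs, abs_mul, abs_of_pos hpos, div_mul_cancel₀ _ (abs_ne_zero.2 hx)] at this
  nlinarith

lemma ggDefect_eq_zero_of_bounded (hg : IsOverlapGaussianProcess P s p g)
    (hstab : ∀ t : ℝ, 0 < t → StochasticallyStableAt P s p g t)
    (hsm : Measurable fun x : I × I × I => s x.1 x.2.1 x.2.2)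
    (hs : ∀ w u v, s w u v ∈ Set.Icc (-1 : ℝ) 1)
    {M : ℝ} (hM : ∀ t : ℝ, 0 < t → |tiltedVariance P s p g t| ≤ M)
    {n : ℕ} {F : (Finset (Fin (n + 1)) → ℝ) → ℝ} (hF : Continuous F) : ggDefect s p F = 0 := by
  obtain ⟨C, hC⟩ := exists_abs_comp_multiOverlap_le hs hF
  refine eq_zero_of_forall_sq_mul_le (B := C ^ 2 * M) fun t ht => ?_
  exact (sq_mul_ggDefect_le (hstab t ht) hg hsm hs hF hC).trans
    (mul_le_mul_of_nonneg_left ((le_abs_self _).trans (hM t ht)) (sq_nonneg C))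

end Converse

end SpinGlass

end

/-! ### The equivalence and the value of the variance. -/

theorem theorem7
    (s : I → I → I → ℝ)
    (hs_meas : Measurable fun x : I × I × I => s x.1 x.2.1 x.2.2)
    (hs_range : ∀ w u v, s w u v ∈ Set.Icc (-1 : ℝ) 1)
    {Ω : Type*} [MeasurableSpace Ω] (P : Measure Ω) [IsProbabilityMeasure P]
    (g : ℕ → I → I → Ω → ℝ)
    (hg : ∀ p : ℕ, 1 ≤ p → SpinGlass.IsOverlapGaussianProcess P s p (g p))
    (hstab : ∀ p : ℕ, 1 ≤ p → ∀ t : ℝ, 0 < t →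
      SpinGlass.StochasticallyStableAt P s p (g p) t) :
    (SpinGlass.GhirlandaGuerra s ↔
      ∀ p : ℕ, 1 ≤ p → ∃ M : ℝ, ∀ t : ℝ, 0 < t →
        |SpinGlass.tiltedVariance P s p (g p) t| ≤ M) ∧
    ((∀ p : ℕ, 1 ≤ p → ∃ M : ℝ, ∀ t : ℝ, 0 < t →
        |SpinGlass.tiltedVariance P s p (g p) t| ≤ M) →
      ∀ p : ℕ, 1 ≤ p → ∀ t : ℝ, 0 < t →
        SpinGlass.tiltedVariance P s p (g p) t = 1) := by
  have hgg := SpinGlass.ghirlandaGuerra_iff hs_meas hs_range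
  have hone : SpinGlass.GhirlandaGuerra s → ∀ p : ℕ, 1 ≤ p → ∀ t : ℝ, 0 < t →
      SpinGlass.tiltedVariance P s p (g p) t = 1 := fun h p hp t ht => by
    rw [SpinGlass.tiltedVariance_eq (hstab p hp t ht) (hg p hp) hs_meas hs_range,
      -- The index `1` stands for two replicas, with `F = R_{0,1}^p`.
      hgg.1 h 1 p hp _ (by fun_prop), mul_zero, sub_zero]
  have hconv : (∀ p : ℕ, 1 ≤ p → ∃ M : ℝ, ∀ t : ℝ, 0 < t →
      |SpinGlass.tiltedVariance P s p (g p) t| ≤ M) → SpinGlass.GhirlandaGuerra s := fun h =>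
    hgg.2 fun n p hp F hF => by
      obtain ⟨M, hM⟩ := h p hp
      exact SpinGlass.ggDefect_eq_zero_of_bounded (hg p hp) (hstab p hp) hs_meas hs_range hM hF
  refine ⟨⟨fun h p hp => ⟨1, fun t ht => ?_⟩, hconv⟩, fun h => hone (hconv h)⟩
  rw [hone h p hp t ht, abs_one]
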